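/- Let $q$ be a power of $2$. Represent a point $P=(y_0,\dots,y_5)$ of $\mathrm{PG}(5,q)$ by the symmetric matrix \[ M_P=\begin{bmatrix} y_0&y_1&y_2\\ y_1&y_3&y_4\\ y_2&y_4&y_5\end{bmatrix}, \] and call the rank of $M_P$ the rank of $P$. Let $\mathcal V(\mathbb F_q)=\{(u_0^2,u_0u_1,u_0u_2,u_1^2,u_1u_2,u_2^2)\}$ be the Veronese surface (the image of $\mathrm{PG}(2,q)$), let $\pi_{\mathcal N}=\mathcal Z(Y_0,Y_3,Y_5)$ be its nucleus plane, and let $K\le \mathrm{PGL}(6,q)$ be the image of $\mathrm{PGL}(3,q)$ under $\alpha$, where $\alpha(\phi_A)$ maps $P$ to the point $Q$ with $M_Q=AM_PA^T$. For a plane $\pi$ of $\mathrm{PG}(5,q)$ let $OD_0(\pi)=[r_1,r_{2,n},r_{2,s},r_3]$, where $r_1$ and $r_3$ are the numbers of points of rank $1$ and $3$ in $\pi$, $r_{2,n}$ is the number of rank-$2$ points in $\pi\cap\pi_{\mathcal N}$, and $r_{2,s}$ is the number of rank-$2$ points in $\pi\setminus(\pi_{\mathcal N}\cup\mathcal V(\mathbb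 F_q))$. The cubic curve associated with $\pi$ is the zero locus of $\det(XM_0+YM_1+ZM_2)$, where $M_0,M_1,M_2$ represent a basis of $\pi$; it is determined up to a linear change of the coordinates $X,Y,Z$. Theorem. There are exactly six $K$-orbits of planes $\pi$ in $\mathrm{PG}(5,q)$ that are disjoint from $\mathcal V(\mathbb F_q)$ and meet $\pi_{\mathcal N}$ in exactly one point. The distribution $OD_0$ is constant on each of them, and they are: (a) exactly one $K$-orbit with $OD_0(\pi)=[0,1,0,q^2+q]$; (b) exactly one $K$-orbit with $OD_0(\pi)=[0,1,3q,q^2-2q]$; (c) exactly two $K$-orbits with $OD_0(\pi)=[0,1,q,q^2]$: one consists of the planes with this distribution whose associated cubic is the union of a line and a pair of conjugate imaginary lines (two distinct lines over $\mathbb F_{q^2}$ that are conjugate over $\mathbb F_q$), the other of those whose associated cubic is (absolutely) irreducible; (d) exactly two $K$-orbits with $OD_0(\pi)=[0,1,2q,q^2-q]$: one consists of the planes with this distribution whose associated cubic is the union of a line and a double line (the two lines being distinct), the other of those whose associated cubic is the union of a non-singular conic and one of its tangent lines. -/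

import Mathlib

open Matrix MatrixGroups LinearAlgebra.Projectivization Pointwise

noncomputable section

namespace VeronesePlanes

universe u

variable {F : Type u} [Field F]

/-- Points of `PG(5,q)`. -/
abbrev PG5 (F : Type u) [Field F] := ℙ F (Fin 6 → F)

/-- Subspaces of `PG(5,q)`. -/
abbrev Subsp5 (F : Type u) [Field F] := Projectivization.Subspace F (Fin 6 → F)

/-! ### Symmetric matrices, rank, Veronese surface, nucleus plane -/

/-- The symmetric matrix of a coordinate vector `(y₀, …, y₅)`. -/
def symMat (v : Fin 6 → F) : Matrix (Fin 3) (Fin 3) F :=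
  !![v 0, v 1, v 2; v 1, v 3, v 4; v 2, v 4, v 5]

/-- The six coordinates of a symmetric matrix (its upper triangular entries). -/
def symCoords (M : Matrix (Fin 3) (Fin 3) F) : Fin 6 → F :=
  ![M 0 0, M 0 1, M 0 2, M 1 1, M 1 2, M 2 2]

/-- The rank of a point of `PG(5,q)`. -/
def pointRank (P : PG5 F) : ℕ := (symMat P.rep).rank

/-- The Veronese map in coordinates. -/
def veroneseVec (u : Fin 3 → F) : Fin 6 → F :=
  ![u 0 ^ 2, u 0 * u 1, u 0 * u 2, u 1 ^ 2, u 1 * u 2, u 2 ^ 2]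

lemma veroneseVec_ne_zero {u : Fin 3 → F} (hu : u ≠ 0) : veroneseVec u ≠ 0 := by
  intro h
  apply hu
  have h0 := congrFun h 0
  have h3 := congrFun h 3
  have h5 := congrFun h 5
  simp [veroneseVec] at h0 h3 h5
  ext i
  fin_cases i <;> simp [h0, h3, h5]

/-- The Veronese surface, the image of `PG(2,q)` under the Veronese embedding. -/
def veroneseSurface (F : Type u) [Field F] : Set (PG5 F) :=
  {P | ∃ (u : Fin 3 → F) (hu : u ≠ 0),
    P = Projectivization.mk F (veroneseVec u) (veroneseVec_ne_zero hu)}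

/-- The vectors with `y₀ = y₃ = y₅ = 0`. -/
def nucleusSubmodule (F : Type u) [Field F] : Submodule F (Fin 6 → F) where
  carrier := {v | v 0 = 0 ∧ v 3 = 0 ∧ v 5 = 0}
  add_mem' := by
    rintro a b ⟨h1, h2, h3⟩ ⟨h4, h5, h6⟩
    simp [h1, h2, h3, h4, h5, h6]
  zero_mem' := by simp
  smul_mem' := by
    rintro c a ⟨h1, h2, h3⟩
    simp [h1, h2, h3]

/-- The nucleus plane `Z(Y₀, Y₃, Y₅)`. -/
def nucleusPlane (F : Type u) [Field F] : Subsp5 F := (nucleusSubmodule F).projectivization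

/-! ### The group `K` -/

lemma symMat_symCoords {M : Matrix (Fin 3) (Fin 3) F} (hM : Mᵀ = M) :
    symMat (symCoords M) = M := by
  have h (i j) : M j i = M i j := congrFun (congrFun hM i) j
  ext i j
  fin_cases i <;> fin_cases j <;> simp [symMat, symCoords, h 0 1, h 0 2, h 1 2]

lemma symCoords_symMat (v : Fin 6 → F) : symCoords (symMat v) = v := by
  ext i
  fin_cases i <;> simp [symMat, symCoords]

lemma symMat_transpose (v : Fin 6 → F) : (symMat v)ᵀ = symMat v := by
  ext i j
  fin_cases i <;> fin_cases j <;> simp [symMat]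

/-- The linear map `P ↦ Q` with `M_Q = A M_P Aᵀ`. -/
def congrLin (A : Matrix (Fin 3) (Fin 3) F) : (Fin 6 → F) →ₗ[F] (Fin 6 → F) where
  toFun v := symCoords (A * symMat v * Aᵀ)
  map_add' v w := by
    have h : symMat (v + w) = symMat v + symMat w := by
      ext i j
      fin_cases i <;> fin_cases j <;> simp [symMat]
    rw [h, Matrix.mul_add, Matrix.add_mul]
    ext i
    fin_cases i <;> simp [symCoords]
  map_smul' c v := by
    have h : symMat (c • v) = c • symMat v := by
      ext i j
      fin_cases i <;> fin_cases j <;> simp [symMat]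
    rw [h, Matrix.mul_smul, Matrix.smul_mul]
    ext i
    fin_cases i <;> simp [symCoords]

lemma symMat_congrLin (A : Matrix (Fin 3) (Fin 3) F) (v : Fin 6 → F) :
    symMat (congrLin A v) = A * symMat v * Aᵀ := by
  refine symMat_symCoords ?_
  simp [Matrix.transpose_mul, symMat_transpose, Matrix.mul_assoc]

/-- `A ↦ (P ↦ A M_P Aᵀ)` as a homomorphism `GL(3,q) → GL(6,q)`. -/
def liftGL (F : Type u) [Field F] : GL (Fin 3) F →* GL (Fin 6) F :=
  Units.map
    { toFun := fun A => LinearMap.toMatrix' (congrLin A)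
      map_one' := by
        have h : congrLin (1 : Matrix (Fin 3) (Fin 3) F) = LinearMap.id := by
          ext1 i
          ext1
          simp [congrLin, symCoords_symMat]
        rw [h, LinearMap.toMatrix'_id]
      map_mul' := fun A B => by
        have h : congrLin (A * B) = (congrLin A).comp (congrLin B) := by
          refine LinearMap.ext fun v => ?_
          change symCoords _ = symCoords _
          rw [symMat_congrLin]
          simp only [Matrix.transpose_mul, Matrix.mul_assoc]
        rw [h, LinearMap.toMatrix'_comp] }

lemma liftGL_mulVec (A : GL (Fin 3) F) (v : Fin 6 → F) :
    (liftGL F A : Matrix (Fin 6) (Fin 6) F) *ᵥ v = congrLin (A : Matrix (Fin 3) (Fin 3) F) v :=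
  LinearMap.toMatrix'_mulVec _ _

lemma mk_liftGL_scalar (c : Fˣ) :
    ProjGenLinGroup.mk (liftGL F (.scalar (Fin 3) c)) = 1 := by
  have h : liftGL F (.scalar (Fin 3) c) = .scalar (Fin 6) (c ^ 2) := by
    refine Units.ext (Matrix.toLin'.injective (LinearMap.ext fun v => ?_))
    simp only [Matrix.toLin'_apply, liftGL_mulVec]
    ext i
    fin_cases i <;>
      simp [congrLin, symCoords, symMat, Matrix.GeneralLinearGroup.scalar,
        Matrix.diagonal_pow, Matrix.mulVec_diagonal] <;> ring
  rw [h, ProjGenLinGroup.mk_scalar]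

/-- The homomorphism `α : PGL(3,q) → PGL(6,q)` induced by `M_Q = A M_P Aᵀ`. -/
def alpha (F : Type u) [Field F] : PGL(3, F) →* PGL(6, F) :=
  QuotientGroup.lift (Subgroup.center (GL (Fin 3) F))
    ((ProjGenLinGroup.mk (n := Fin 6) (R := F)).comp (liftGL F)) (by
      intro A hA
      rw [Matrix.GeneralLinearGroup.center_eq_range_scalar] at hA
      obtain ⟨c, rfl⟩ := hA
      exact mk_liftGL_scalar c)

/-- The group `K = α(PGL(3,q))`. -/
def groupK (F : Type u) [Field F] : Subgroup PGL(6, F) := (alpha F).range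

/-- On points, `α` is the action `M_P ↦ A M_P Aᵀ`. -/
lemma alpha_mk_smul_mk (A : GL (Fin 3) F) {v : Fin 6 → F} (hv : v ≠ 0) :
    ∃ hw : symCoords ((A : Matrix (Fin 3) (Fin 3) F) * symMat v *
        (A : Matrix (Fin 3) (Fin 3) F)ᵀ) ≠ 0,
      alpha F (ProjGenLinGroup.mk A) • Projectivization.mk F v hv = Projectivization.mk F _ hw := by
  have h : liftGL F A • v = congrLin (A : Matrix (Fin 3) (Fin 3) F) v := liftGL_mulVec A v
  have h0 : liftGL F A • v ≠ 0 := (smul_ne_zero_iff_ne _).mpr hv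
  refine ⟨fun hz => h0 (h.trans hz), ?_⟩
  change ProjGenLinGroup.mk (liftGL F A) • Projectivization.mk F v hv = _
  rw [Projectivization.PGL.mk_smul_mk]
  congr 1

/-- The `K`-orbit of a subspace of `PG(5,q)`. -/
def kOrbit (W : Subsp5 F) : Set (Subsp5 F) :=
  {W' | ∃ g ∈ groupK F, (W' : Set (PG5 F)) = g • (W : Set (PG5 F))}

/-! ### Point-orbit distributions -/

/-- `OD₀(W) = [r₁, r₂ₙ, r₂ₛ, r₃]`. -/
def OD0 (W : Subsp5 F) : Fin 4 → ℕ :=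
  ![{P : PG5 F | P ∈ W ∧ pointRank P = 1}.ncard,
    {P : PG5 F | P ∈ W ∧ pointRank P = 2 ∧ P ∈ nucleusPlane F}.ncard,
    {P : PG5 F | P ∈ W ∧ pointRank P = 2 ∧ P ∉ nucleusPlane F ∧ P ∉ veroneseSurface F}.ncard,
    {P : PG5 F | P ∈ W ∧ pointRank P = 3}.ncard]

/-- The planes of `PG(5,q)` disjoint from the Veronese surface and meeting the nucleus plane
in exactly one point. -/
def nucleusPointPlanes (F : Type u) [Field F] : Set (Subsp5 F) :=
  {W | Module.finrank F (Projectivization.Subspace.submodule W) = 3 ∧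
    Disjoint (W : Set (PG5 F)) (veroneseSurface F) ∧
    ∃ P : PG5 F, (W : Set (PG5 F)) ∩ (nucleusPlane F : Set (PG5 F)) = {P}}

/-- The `K`-orbits of these planes. -/
def orbits (F : Type u) [Field F] : Set (Set (Subsp5 F)) := kOrbit '' nucleusPointPlanes F

/-- The `K`-orbits of these planes with point-orbit distribution `d`. -/
def orbitsWithOD (F : Type u) [Field F] (d : Fin 4 → ℕ) : Set (Set (Subsp5 F)) :=
  {O | O ∈ orbits F ∧ ∀ W ∈ O, OD0 W = d}

/-! ### The cubic curve of a plane -/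

/-- The cubic form `det (X₀ M₀ + X₁ M₁ + X₂ M₂)`, where `M₀, M₁, M₂` are the symmetric matrices of
a basis of the plane `W`. Another basis changes it by an invertible linear substitution. -/
def cubicForm {W : Subsp5 F}
    (b : Module.Basis (Fin 3) F (Projectivization.Subspace.submodule W)) :
    MvPolynomial (Fin 3) F :=
  (∑ i : Fin 3, (MvPolynomial.X i : MvPolynomial (Fin 3) F) •
    (symMat (b i : Fin 6 → F)).map (MvPolynomial.C : F →+* MvPolynomial (Fin 3) F)).det

/-- A pair of conjugate imaginary lines: two distinct lines over the quadratic extension of the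
field that are exchanged by its nontrivial automorphism. -/
def IsImaginaryLinePair (Q : MvPolynomial (Fin 3) F) : Prop :=
  ∃ (L : Type u) (_ : Field L) (_ : Algebra F L) (σ : L ≃ₐ[F] L) (m : MvPolynomial (Fin 3) L)
    (c : L), Module.finrank F L = 2 ∧ m.IsHomogeneous 1 ∧ c ≠ 0 ∧
    LinearIndependent L ![m, m.map (σ : L →+* L)] ∧
    Q.map (algebraMap F L) = MvPolynomial.C c * (m * m.map (σ : L →+* L))

/-- The cubic is the union of a line and a pair of conjugate imaginary lines. -/
def IsLineAndImaginaryPair (f : MvPolynomial (Fin 3) F) : Prop :=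
  ∃ l Q : MvPolynomial (Fin 3) F, l.IsHomogeneous 1 ∧ l ≠ 0 ∧ IsImaginaryLinePair Q ∧ f = l * Q

/-- The cubic is (absolutely) irreducible. -/
def IsAbsolutelyIrreducible (f : MvPolynomial (Fin 3) F) : Prop :=
  Irreducible (f.map (algebraMap F (AlgebraicClosure F)))

/-- The cubic is the union of a line and a double line, the two lines being distinct. -/
def IsLineAndDoubleLine (f : MvPolynomial (Fin 3) F) : Prop :=
  ∃ l m : MvPolynomial (Fin 3) F, l.IsHomogeneous 1 ∧ m.IsHomogeneous 1 ∧
    LinearIndependent F ![l, m] ∧ f = l * m ^ 2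

/-- `Q` is the form of a non-singular conic. -/
def IsNonsingularConic (Q : MvPolynomial (Fin 3) F) : Prop :=
  Q.IsHomogeneous 2 ∧ ∀ v : Fin 3 → AlgebraicClosure F, v ≠ 0 → MvPolynomial.aeval v Q = 0 →
    ∃ i, MvPolynomial.aeval v (MvPolynomial.pderiv i Q) ≠ 0

/-- `l` is the form of the tangent line of the conic `Q` at one of its rational points. -/
def IsTangentLine (l Q : MvPolynomial (Fin 3) F) : Prop :=
  ∃ (p : Fin 3 → F) (c : F), p ≠ 0 ∧ c ≠ 0 ∧ MvPolynomial.eval p Q = 0 ∧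
    l = MvPolynomial.C c * ∑ i : Fin 3,
      MvPolynomial.C (MvPolynomial.eval p (MvPolynomial.pderiv i Q)) * MvPolynomial.X i

/-- The cubic is the union of a non-singular conic and one of its tangent lines. -/
def IsConicAndTangent (f : MvPolynomial (Fin 3) F) : Prop :=
  ∃ l Q : MvPolynomial (Fin 3) F, IsNonsingularConic Q ∧ IsTangentLine l Q ∧ f = l * Q

/-- The planes under consideration with point-orbit distribution `d` whose associated cubic is of
type `T`, where `T` is a property of cubic forms invariant under linear substitutions. -/
def planesOfType (d : Fin 4 → ℕ) (T : MvPolynomial (Fin 3) F → Prop) : Set (Subsp5 F) :=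
  {W | W ∈ nucleusPointPlanes F ∧ OD0 W = d ∧
    ∀ b : Module.Basis (Fin 3) F (Projectivization.Subspace.submodule W), T (cubicForm b)}

end VeronesePlanes

end

open Matrix MatrixGroups LinearAlgebra.Projectivization Pointwise

noncomputable section

namespace VeronesePlanes

universe u

variable {F : Type u} [Field F]

open Projectivization.Subspace (submodule)

/-! ### Squares in a finite field of characteristic two -/

section Squares

variable [CharP F 2]

/-! In characteristic 2 the diagonal of `A M Aᵀ` is the diagonal of `M` multiplied by the matrix of
squared entries of `A` (`congrLin_diag`), and the nucleus plane is the kernel of the diagonal map. A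
plane meeting it in one point thus has a two-dimensional space of diagonals. Every element of `F` is
a square, so some congruence makes the last diagonal entry vanish on the whole plane. The nucleus
point is an alternating matrix that can then be normalised to one of two positions, which gives the
families `planeI` and `planeII` (`IsNucleusPointSpace.exists_congruent`).

For `planeI` let `T` have rows `(α, β)`, `(γ, δ)`, and let a superscript `(2)` denote entrywise
squaring. Disjointness from the Veronese surface means `det T ≠ 0`, and the congruence by `diag(B,
1)` carries `T` to `T'` when `B T = T' B⁽²⁾`: conjugacy twisted by squaring (`congruent_planeI`).
Over the algebraic closure the solutions of `T w⁽²⁾ = w` form a two-dimensional space over the field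
with two elements, and the `q`-Frobenius fixes three, one or none of its nonzero vectors; each case
is one orbit. A rational solution brings `T` to the form `(1, e; 0, 1)`, where only the class of `e`
modulo the values `x² + x` matters, and these values have index 2. Without a rational solution there
is one over the cubic extension, and its coordinates form a basis of the trace-zero elements;
comparing two such bases yields `B` (`IsCubicFixedVector.congruent`). The cubic consists of three
concurrent lines matching the three nonzero solutions, so 3, 1 or 0 of them are rational.

For `planeII` elementary eliminations leave three cases (`congruent_of_planeII`): `δ ≠ 0`, `δ = 0 ≠
γ`, and `γ = δ = 0`, the last again controlled by an Artin–Schreier class. Their cubics are a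
cuspidal cubic, a conic with a tangent line, and a line with a double line.

Finally `OD0` depends only on the number of rational points of the cubic (`OD0_eq`). This separates
the six orbits except for two pairs, which the type of the cubic separates. -/

lemma add_sq_char_two (x y : F) : (x + y) ^ 2 = x ^ 2 + y ^ 2 := CharTwo.add_sq x y

lemma sq_injective_char_two {x y : F} (h : x ^ 2 = y ^ 2) : x = y := by
  have h1 : (x + y) ^ 2 = 0 := by
    rw [add_sq_char_two, h]
    exact CharTwo.add_self_eq_zero _
  exact CharTwo.add_eq_zero.mp (pow_eq_zero_iff (two_ne_zero) |>.mp h1)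

lemma exists_sq_eq [Finite F] (x : F) : ∃ y : F, y ^ 2 = x := by
  obtain ⟨y, hy⟩ := FiniteField.isSquare_of_char_two (ringChar.eq F 2) x
  exact ⟨y, by rw [hy, sq]⟩

end Squares

/-! ### Congruence of subspaces -/

lemma congrLin_mul_apply (A B : Matrix (Fin 3) (Fin 3) F) (v : Fin 6 → F) :
    congrLin (A * B) v = congrLin A (congrLin B v) := by
  change symCoords _ = symCoords _
  rw [symMat_congrLin]
  simp only [Matrix.transpose_mul, Matrix.mul_assoc]

lemma congrLin_one_apply (v : Fin 6 → F) : congrLin (1 : Matrix (Fin 3) (Fin 3) F) v = v := by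
  simp [congrLin, symCoords_symMat]

lemma congrLin_inv_apply {A : Matrix (Fin 3) (Fin 3) F} (hA : A.det ≠ 0) (v : Fin 6 → F) :
    congrLin A⁻¹ (congrLin A v) = v := by
  rw [← congrLin_mul_apply, Matrix.nonsing_inv_mul _ (Ne.isUnit hA), congrLin_one_apply]

lemma congrLin_apply_inv {A : Matrix (Fin 3) (Fin 3) F} (hA : A.det ≠ 0) (v : Fin 6 → F) :
    congrLin A (congrLin A⁻¹ v) = v := by
  rw [← congrLin_mul_apply, Matrix.mul_nonsing_inv _ (Ne.isUnit hA), congrLin_one_apply]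

lemma congrLin_injective {A : Matrix (Fin 3) (Fin 3) F} (hA : A.det ≠ 0) :
    Function.Injective (congrLin A) :=
  Function.LeftInverse.injective (congrLin_inv_apply hA)

lemma det_inv_ne_zero {A : Matrix (Fin 3) (Fin 3) F} (hA : A.det ≠ 0) : A⁻¹.det ≠ 0 := by
  rw [Matrix.det_nonsing_inv]
  simpa using hA

lemma mem_map_congrLin {A : Matrix (Fin 3) (Fin 3) F} (hA : A.det ≠ 0)
    (S : Submodule F (Fin 6 → F)) (v : Fin 6 → F) :
    v ∈ S.map (congrLin A) ↔ congrLin A⁻¹ v ∈ S := by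
  constructor
  · rintro ⟨w, hw, rfl⟩
    rwa [congrLin_inv_apply hA]
  · intro h
    exact ⟨_, h, congrLin_apply_inv hA v⟩

/-- Two subspaces of `F⁶` are congruent if some `M ↦ A M Aᵀ` maps one onto the other. -/
def SymCongruent (S S' : Submodule F (Fin 6 → F)) : Prop :=
  ∃ A : Matrix (Fin 3) (Fin 3) F, A.det ≠ 0 ∧ S.map (congrLin A) = S'

lemma SymCongruent.refl (S : Submodule F (Fin 6 → F)) : SymCongruent S S := by
  refine ⟨1, by simp, ?_⟩
  ext v
  rw [mem_map_congrLin (by simp)]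
  simp [congrLin_one_apply]

lemma SymCongruent.symm {S S' : Submodule F (Fin 6 → F)} (h : SymCongruent S S') : SymCongruent S' S := by
  obtain ⟨A, hA, rfl⟩ := h
  refine ⟨A⁻¹, det_inv_ne_zero hA, ?_⟩
  ext v
  rw [mem_map_congrLin (det_inv_ne_zero hA), mem_map_congrLin hA,
    congrLin_apply_inv (det_inv_ne_zero hA)]

lemma SymCongruent.trans {S S' S'' : Submodule F (Fin 6 → F)} (h : SymCongruent S S')
    (h' : SymCongruent S' S'') : SymCongruent S S'' := by
  obtain ⟨A, hA, rfl⟩ := h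
  obtain ⟨B, hB, rfl⟩ := h'
  refine ⟨B * A, by simp [hA, hB], ?_⟩
  rw [← Submodule.map_comp]
  congr 1
  exact LinearMap.ext fun v => congrLin_mul_apply B A v

/-- With equal dimensions an inclusion is enough, so every later congruence only needs the defining
equations of the target plane to be checked. -/
lemma congruent_of_le {S S' : Submodule F (Fin 6 → F)} (A : Matrix (Fin 3) (Fin 3) F)
    (hA : A.det ≠ 0) (hd : Module.finrank F S = Module.finrank F S')
    (h : ∀ v ∈ S, congrLin A v ∈ S') : SymCongruent S S' := by
  refine ⟨A, hA, Submodule.eq_of_le_of_finrank_eq ?_ ?_⟩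
  · rintro _ ⟨v, hv, rfl⟩
    exact h v hv
  · rw [← hd]
    exact (Submodule.equivMapOfInjective _ (congrLin_injective hA) S).finrank_eq.symm

lemma SymCongruent.finrank_eq {S S' : Submodule F (Fin 6 → F)} (h : SymCongruent S S') :
    Module.finrank F S' = Module.finrank F S := by
  obtain ⟨A, hA, rfl⟩ := h
  exact (Submodule.equivMapOfInjective _ (congrLin_injective hA) S).finrank_eq.symm

/-- The bridge from projective point sets to linear algebra; from here on, orbits are classes of
submodules under `SymCongruent`. -/
lemma coe_eq_alpha_smul_iff (A : GL (Fin 3) F) (W W' : Subsp5 F) :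
    (W' : Set (PG5 F)) = alpha F (ProjGenLinGroup.mk A) • (W : Set (PG5 F)) ↔
      (submodule W).map (congrLin (A : Matrix (Fin 3) (Fin 3) F)) = submodule W' := by
  have hA : (A : Matrix (Fin 3) (Fin 3) F).det ≠ 0 := by
    rw [← Matrix.GeneralLinearGroup.val_det_apply]
    exact Units.ne_zero _
  have key (v : Fin 6 → F) (hv : v ≠ 0) :
      Projectivization.mk F v hv ∈ alpha F (ProjGenLinGroup.mk A) • (W : Set (PG5 F)) ↔
        v ∈ (submodule W).map (congrLin (A : Matrix (Fin 3) (Fin 3) F)) := by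
    rw [Set.mem_smul_set_iff_inv_smul_mem, ← map_inv, ← map_inv, mem_map_congrLin hA]
    obtain ⟨hw, h⟩ := alpha_mk_smul_mk A⁻¹ hv
    rw [h, SetLike.mem_coe, ← Projectivization.Subspace.mem_submodule_iff]
    simp [congrLin, Matrix.coe_units_inv]
  constructor
  · intro h
    ext v
    rcases eq_or_ne v 0 with rfl | hv
    · simp
    · rw [← key v hv, ← h, SetLike.mem_coe, Projectivization.Subspace.mem_submodule_iff]
  · intro h
    ext P
    induction P using Projectivization.ind with | h v hv =>
    rw [key v hv, h, SetLike.mem_coe, Projectivization.Subspace.mem_submodule_iff]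

lemma mem_kOrbit_iff (W W' : Subsp5 F) :
    W' ∈ kOrbit W ↔ SymCongruent (submodule W) (submodule W') := by
  constructor
  · rintro ⟨g, ⟨x, rfl⟩, h⟩
    obtain ⟨A, rfl⟩ := ProjGenLinGroup.mk_surjective x
    refine ⟨A, ?_, (coe_eq_alpha_smul_iff A W W').mp h⟩
    rw [← Matrix.GeneralLinearGroup.val_det_apply]
    exact Units.ne_zero _
  · rintro ⟨A, hA, h⟩
    exact ⟨_, ⟨ProjGenLinGroup.mk (Matrix.GeneralLinearGroup.mkOfDetNeZero A hA), rfl⟩,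
      (coe_eq_alpha_smul_iff _ W W').mpr h⟩

lemma kOrbit_eq_iff (W W' : Subsp5 F) :
    kOrbit W = kOrbit W' ↔ SymCongruent (submodule W) (submodule W') := by
  constructor
  · intro h
    rw [← mem_kOrbit_iff, h, mem_kOrbit_iff]
    exact SymCongruent.refl _
  · intro h
    ext V
    rw [mem_kOrbit_iff, mem_kOrbit_iff]
    exact ⟨fun h' => h.symm.trans h', fun h' => h.trans h'⟩

/-! ### Planes meeting the nucleus plane in a point -/

/-- The subspaces of `F⁶` that underlie the planes of `nucleusPointPlanes`. -/
structure IsNucleusPointSpace (S : Submodule F (Fin 6 → F)) : Prop where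
  finrank_eq : Module.finrank F S = 3
  veroneseVec_notMem : ∀ u : Fin 3 → F, u ≠ 0 → veroneseVec u ∉ S
  exists_span : ∃ n : Fin 6 → F, n ≠ 0 ∧ S ⊓ nucleusSubmodule F = Submodule.span F {n}

lemma mk_mem_nucleusPlane_iff {v : Fin 6 → F} (hv : v ≠ 0) :
    Projectivization.mk F v hv ∈ nucleusPlane F ↔ v 0 = 0 ∧ v 3 = 0 ∧ v 5 = 0 :=
  Submodule.mk_mem_projectivization_iff _ hv

lemma mem_nucleusSubmodule {v : Fin 6 → F} :
    v ∈ nucleusSubmodule F ↔ v 0 = 0 ∧ v 3 = 0 ∧ v 5 = 0 := Iff.rfl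

lemma mem_nucleusPointPlanes_iff (W : Subsp5 F) :
    W ∈ nucleusPointPlanes F ↔ IsNucleusPointSpace (submodule W) := by
  constructor
  · rintro ⟨h1, h2, P, h3⟩
    refine ⟨h1, fun u hu hmem => ?_, ?_⟩
    · refine Set.disjoint_left.mp h2 ?_ ⟨u, hu, rfl⟩
      exact (Projectivization.Subspace.mem_submodule_iff W (veroneseVec_ne_zero hu)).mp hmem
    · have hP : P ∈ (W : Set (PG5 F)) ∩ (nucleusPlane F : Set (PG5 F)) := h3 ▸ rfl
      induction P using Projectivization.ind with | h n hn =>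
      refine ⟨n, hn, le_antisymm ?_ ?_⟩
      · rintro v ⟨hv1, hv2⟩
        rcases eq_or_ne v 0 with rfl | hv
        · exact Submodule.zero_mem _
        have : Projectivization.mk F v hv ∈
            (W : Set (PG5 F)) ∩ (nucleusPlane F : Set (PG5 F)) :=
          ⟨(Projectivization.Subspace.mem_submodule_iff W hv).mp hv1,
            (mk_mem_nucleusPlane_iff hv).mpr hv2⟩
        rw [h3, Set.mem_singleton_iff, Projectivization.mk_eq_mk_iff'] at this
        exact Submodule.mem_span_singleton.mpr this
      · rw [Submodule.span_singleton_le_iff_mem]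
        exact ⟨(Projectivization.Subspace.mem_submodule_iff W hn).mpr hP.1,
          (mk_mem_nucleusPlane_iff hn).mp hP.2⟩
  · rintro ⟨h1, h2, n, hn, h3⟩
    refine ⟨h1, ?_, Projectivization.mk F n hn, ?_⟩
    · rw [Set.disjoint_left]
      rintro _ hP ⟨u, hu, rfl⟩
      exact h2 u hu ((Projectivization.Subspace.mem_submodule_iff W _).mpr hP)
    · ext P
      induction P using Projectivization.ind with | h v hv =>
      rw [Set.mem_singleton_iff, Projectivization.mk_eq_mk_iff', ← Submodule.mem_span_singleton,
        ← h3, Submodule.mem_inf, Projectivization.Subspace.mem_submodule_iff W hv,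
        mem_nucleusSubmodule, ← mk_mem_nucleusPlane_iff hv]
      rfl

lemma congrLin_veroneseVec (A : Matrix (Fin 3) (Fin 3) F) (u : Fin 3 → F) :
    congrLin A (veroneseVec u) = veroneseVec (A *ᵥ u) := by
  have h (w : Fin 3 → F) : symMat (veroneseVec w) = vecMulVec w w := by
    ext i j
    fin_cases i <;> fin_cases j <;> simp [symMat, veroneseVec, vecMulVec_apply] <;> ring
  rw [← symCoords_symMat (congrLin A _), symMat_congrLin, ← symCoords_symMat (veroneseVec (A *ᵥ u)),
    h, h, Matrix.mul_vecMulVec, Matrix.vecMulVec_mul, Matrix.vecMul_transpose]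

section Diagonal

variable [CharP F 2]

/-- By symmetry each off-diagonal entry enters a diagonal entry of `A M Aᵀ` twice, hence cancels in
characteristic 2. -/
lemma congrLin_diag (A : Matrix (Fin 3) (Fin 3) F) (v : Fin 6 → F) :
    congrLin A v 0 = A 0 0 ^ 2 * v 0 + A 0 1 ^ 2 * v 3 + A 0 2 ^ 2 * v 5 ∧
    congrLin A v 3 = A 1 0 ^ 2 * v 0 + A 1 1 ^ 2 * v 3 + A 1 2 ^ 2 * v 5 ∧
    congrLin A v 5 = A 2 0 ^ 2 * v 0 + A 2 1 ^ 2 * v 3 + A 2 2 ^ 2 * v 5 := by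
  have h2 : (2 : F) = 0 := CharTwo.two_eq_zero
  refine ⟨?_, ?_, ?_⟩ <;>
    simp [congrLin, symCoords, symMat, Matrix.mul_apply, Fin.sum_univ_three]
  · linear_combination (A 0 0 * A 0 1 * v 1 + A 0 0 * A 0 2 * v 2 + A 0 1 * A 0 2 * v 4) * h2
  · linear_combination (A 1 0 * A 1 1 * v 1 + A 1 0 * A 1 2 * v 2 + A 1 1 * A 1 2 * v 4) * h2
  · linear_combination (A 2 0 * A 2 1 * v 1 + A 2 0 * A 2 2 * v 2 + A 2 1 * A 2 2 * v 4) * h2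

lemma congrLin_mem_nucleusSubmodule (A : Matrix (Fin 3) (Fin 3) F) {v : Fin 6 → F}
    (hv : v ∈ nucleusSubmodule F) : congrLin A v ∈ nucleusSubmodule F := by
  obtain ⟨h0, h3, h5⟩ := hv
  obtain ⟨e0, e3, e5⟩ := congrLin_diag A v
  refine ⟨?_, ?_, ?_⟩ <;> simp [*]

lemma SymCongruent.isNucleusPointSpace {S S' : Submodule F (Fin 6 → F)} (h : SymCongruent S S')
    (hS : IsNucleusPointSpace S) : IsNucleusPointSpace S' := by
  obtain ⟨h1, h2, n, hn, h3⟩ := hS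
  refine ⟨h.finrank_eq.trans h1, ?_, ?_⟩ <;> obtain ⟨A, hA, rfl⟩ := h
  · intro u hu hmem
    rw [mem_map_congrLin hA, congrLin_veroneseVec] at hmem
    refine h2 _ (fun h0 => hu ?_) hmem
    have := congrArg (A *ᵥ ·) h0
    simpa [Matrix.mulVec_mulVec, Matrix.mul_nonsing_inv _ (Ne.isUnit hA)] using this
  · refine ⟨congrLin A n, fun h0 => hn (congrLin_injective hA (h0.trans (map_zero _).symm)), ?_⟩
    rw [← Set.image_singleton, ← Submodule.map_span, ← h3]
    ext v
    rw [mem_map_congrLin hA, Submodule.mem_inf, Submodule.mem_inf, mem_map_congrLin hA]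
    refine and_congr_right fun _ => ⟨congrLin_mem_nucleusSubmodule _, fun h' => ?_⟩
    have := congrLin_mem_nucleusSubmodule A h'
    rwa [congrLin_apply_inv hA] at this

end Diagonal

/-! ### Coordinates for the two families of planes -/

/-- The planes whose point in the nucleus plane is `(0,1,0,0,0,0)`. -/
def planeI (α β γ δ : F) : (Fin 3 → F) →ₗ[F] (Fin 6 → F) where
  toFun x := ![x 0, x 2, α * x 0 + β * x 1, x 1, γ * x 0 + δ * x 1, 0]
  map_add' x y := by
    ext i
    fin_cases i <;> simp <;> ring
  map_smul' c x := by
    ext i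
    fin_cases i <;> simp <;> ring

/-- The planes whose point in the nucleus plane is `(0,0,0,0,1,0)`. -/
def planeII (α β γ δ : F) : (Fin 3 → F) →ₗ[F] (Fin 6 → F) where
  toFun x := ![x 0, α * x 0 + β * x 1, γ * x 0 + δ * x 1, x 1, x 2, 0]
  map_add' x y := by
    ext i
    fin_cases i <;> simp <;> ring
  map_smul' c x := by
    ext i
    fin_cases i <;> simp <;> ring

lemma planeI_apply (α β γ δ : F) (x : Fin 3 → F) : planeI α β γ δ x =
    ![x 0, x 2, α * x 0 + β * x 1, x 1, γ * x 0 + δ * x 1, 0] := rfl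

lemma planeII_apply (α β γ δ : F) (x : Fin 3 → F) : planeII α β γ δ x =
    ![x 0, α * x 0 + β * x 1, γ * x 0 + δ * x 1, x 1, x 2, 0] := rfl

lemma planeI_injective (α β γ δ : F) : Function.Injective (planeI α β γ δ) := by
  intro x y h
  have h0 := congrFun h 0
  have h1 := congrFun h 1
  have h3 := congrFun h 3
  simp [planeI_apply] at h0 h1 h3
  ext i
  fin_cases i <;> assumption

lemma planeII_injective (α β γ δ : F) : Function.Injective (planeII α β γ δ) := by
  intro x y h
  have h0 := congrFun h 0
  have h1 := congrFun h 3
  have h3 := congrFun h 4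
  simp [planeII_apply] at h0 h1 h3
  ext i
  fin_cases i <;> assumption

lemma finrank_range_of_injective {φ : (Fin 3 → F) →ₗ[F] (Fin 6 → F)} (h : Function.Injective φ) :
    Module.finrank F (LinearMap.range φ) = 3 := by
  rw [LinearMap.finrank_range_of_inj h]
  simp

lemma finrank_range_planeI (α β γ δ : F) :
    Module.finrank F (LinearMap.range (planeI α β γ δ)) = 3 :=
  finrank_range_of_injective (planeI_injective α β γ δ)

lemma finrank_range_planeII (α β γ δ : F) :
    Module.finrank F (LinearMap.range (planeII α β γ δ)) = 3 :=
  finrank_range_of_injective (planeII_injective α β γ δ)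

lemma mem_range_planeI {α β γ δ : F} {v : Fin 6 → F} : v ∈ LinearMap.range (planeI α β γ δ) ↔
    v 2 = α * v 0 + β * v 3 ∧ v 4 = γ * v 0 + δ * v 3 ∧ v 5 = 0 := by
  constructor
  · rintro ⟨x, rfl⟩
    simp [planeI_apply]
  · rintro ⟨h2, h4, h5⟩
    refine ⟨![v 0, v 3, v 1], ?_⟩
    ext i
    fin_cases i <;> simp [planeI_apply, h2, h4, h5]

lemma mem_range_planeII {α β γ δ : F} {v : Fin 6 → F} : v ∈ LinearMap.range (planeII α β γ δ) ↔
    v 1 = α * v 0 + β * v 3 ∧ v 2 = γ * v 0 + δ * v 3 ∧ v 5 = 0 := by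
  constructor
  · rintro ⟨x, rfl⟩
    simp [planeII_apply]
  · rintro ⟨h2, h4, h5⟩
    refine ⟨![v 0, v 3, v 4], ?_⟩
    ext i
    fin_cases i <;> simp [planeII_apply, h2, h4, h5]

/-! ### Reduction to the two families -/

lemma congrLin_apply (A : Matrix (Fin 3) (Fin 3) F) (v : Fin 6 → F) :
    congrLin A v = symCoords (A * symMat v * Aᵀ) := rfl

lemma exists_det_ne_zero_row {k : Fin 3 → F} (hk : k ≠ 0) :
    ∃ A : Matrix (Fin 3) (Fin 3) F, A.det ≠ 0 ∧ A 2 = k := by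
  by_cases h2 : k 2 = 0
  · by_cases h1 : k 1 = 0
    · have h0 : k 0 ≠ 0 := by
        intro h0
        apply hk
        ext i
        fin_cases i <;> assumption
      refine ⟨!![0, 1, 0; 0, 0, 1; k 0, k 1, k 2], by simp [Matrix.det_fin_three, h0], ?_⟩
      ext i
      fin_cases i <;> simp
    · refine ⟨!![1, 0, 0; 0, 0, 1; k 0, k 1, k 2], by simp [Matrix.det_fin_three, h1], ?_⟩
      ext i
      fin_cases i <;> simp
  · refine ⟨!![1, 0, 0; 0, 1, 0; k 0, k 1, k 2], by simp [Matrix.det_fin_three, h2], ?_⟩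
    ext i
    fin_cases i <;> simp

/-- The diagonal of a symmetric matrix. -/
def diagLin (F : Type u) [Field F] : (Fin 6 → F) →ₗ[F] (Fin 3 → F) where
  toFun v := ![v 0, v 3, v 5]
  map_add' x y := by
    ext i
    fin_cases i <;> simp
  map_smul' c x := by
    ext i
    fin_cases i <;> simp

/-- When the last diagonal entry vanishes on `S`, the kernel of `(v 0, v 3)` on `S` is the
intersection with the nucleus, of dimension 1. The image then has dimension 2, so these two entries
are free parameters of the plane. -/
lemma IsNucleusPointSpace.exists_mem_of_last_eq_zero {S : Submodule F (Fin 6 → F)}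
    (hS : IsNucleusPointSpace S) (h5 : ∀ v ∈ S, v 5 = 0) (x y : F) :
    ∃ v ∈ S, v 0 = x ∧ v 3 = y := by
  obtain ⟨n, hn, hspan⟩ := hS.exists_span
  let d : S →ₗ[F] F × F :=
    ((LinearMap.proj 0).prod (LinearMap.proj 3) : (Fin 6 → F) →ₗ[F] F × F).comp S.subtype
  have hker : (LinearMap.ker d).map S.subtype = S ⊓ nucleusSubmodule F := by
    ext v
    rw [Submodule.mem_map, Submodule.mem_inf, mem_nucleusSubmodule]
    constructor
    · rintro ⟨⟨w, hw⟩, hd, rfl⟩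
      have hd' : (w 0, w 3) = 0 := hd
      rw [Prod.mk_eq_zero] at hd'
      exact ⟨hw, hd'.1, hd'.2, h5 w hw⟩
    · rintro ⟨hv, h0, h3, -⟩
      refine ⟨⟨v, hv⟩, ?_, rfl⟩
      change (v 0, v 3) = 0
      simp [h0, h3]
  have hfin : Module.finrank F (LinearMap.ker d) = 1 := by
    rw [(Submodule.equivMapOfInjective S.subtype S.injective_subtype _).finrank_eq, hker, hspan]
    exact finrank_span_singleton hn
  have h1 := LinearMap.finrank_range_add_finrank_ker d
  rw [hfin, hS.finrank_eq] at h1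
  have htop : LinearMap.range d = ⊤ := by
    apply Submodule.eq_top_of_finrank_eq
    rw [Module.finrank_prod, Module.finrank_self]
    omega
  obtain ⟨⟨v, hv⟩, hd⟩ : (x, y) ∈ LinearMap.range d := htop ▸ Submodule.mem_top
  have hd' : (v 0, v 3) = (x, y) := hd
  rw [Prod.mk.injEq] at hd'
  exact ⟨v, hv, hd'⟩

lemma IsNucleusPointSpace.eq_range_planeI {S : Submodule F (Fin 6 → F)}
    (hS : IsNucleusPointSpace S) (h5 : ∀ v ∈ S, v 5 = 0) (hn : ![0, 1, 0, 0, 0, 0] ∈ S) :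
    ∃ α β γ δ, S = LinearMap.range (planeI α β γ δ) := by
  obtain ⟨v, hv, hv0, hv3⟩ := hS.exists_mem_of_last_eq_zero h5 1 0
  obtain ⟨w, hw, hw0, hw3⟩ := hS.exists_mem_of_last_eq_zero h5 0 1
  refine ⟨v 2, w 2, v 4, w 4, (Submodule.eq_of_le_of_finrank_eq ?_ ?_).symm⟩
  · rintro _ ⟨x, rfl⟩
    have h : planeI (v 2) (w 2) (v 4) (w 4) x = x 0 • v + x 1 • w +
        (x 2 - x 0 * v 1 - x 1 * w 1) • ![0, 1, 0, 0, 0, 0] := by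
      ext i
      fin_cases i <;> simp [planeI_apply, hv0, hw0, hv3, hw3, h5 v hv, h5 w hw] <;> ring
    rw [h]
    exact S.add_mem (S.add_mem (S.smul_mem _ hv) (S.smul_mem _ hw)) (S.smul_mem _ hn)
  · rw [finrank_range_planeI, hS.finrank_eq]

lemma IsNucleusPointSpace.eq_range_planeII {S : Submodule F (Fin 6 → F)}
    (hS : IsNucleusPointSpace S) (h5 : ∀ v ∈ S, v 5 = 0) (hn : ![0, 0, 0, 0, 1, 0] ∈ S) :
    ∃ α β γ δ, S = LinearMap.range (planeII α β γ δ) := by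
  obtain ⟨v, hv, hv0, hv3⟩ := hS.exists_mem_of_last_eq_zero h5 1 0
  obtain ⟨w, hw, hw0, hw3⟩ := hS.exists_mem_of_last_eq_zero h5 0 1
  refine ⟨v 1, w 1, v 2, w 2, (Submodule.eq_of_le_of_finrank_eq ?_ ?_).symm⟩
  · rintro _ ⟨x, rfl⟩
    have h : planeII (v 1) (w 1) (v 2) (w 2) x = x 0 • v + x 1 • w +
        (x 2 - x 0 * v 4 - x 1 * w 4) • ![0, 0, 0, 0, 1, 0] := by
      ext i
      fin_cases i <;> simp [planeII_apply, hv0, hw0, hv3, hw3, h5 v hv, h5 w hw] <;> ring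
    rw [h]
    exact S.add_mem (S.add_mem (S.smul_mem _ hv) (S.smul_mem _ hw)) (S.smul_mem _ hn)
  · rw [finrank_range_planeII, hS.finrank_eq]

section Reduction

variable [CharP F 2]

lemma exists_congrLin_nucleus (x y z : F) (h : y ≠ 0 ∨ z ≠ 0) :
    ∃ A : Matrix (Fin 3) (Fin 3) F, A.det ≠ 0 ∧ A 2 0 = 0 ∧ A 2 1 = 0 ∧
      congrLin A ![0, x, y, 0, z, 0] = ![0, 0, 0, 0, 1, 0] := by
  have h2 : (2 : F) = 0 := CharTwo.two_eq_zero
  by_cases hz : z = 0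
  · have hy : y ≠ 0 := by tauto
    -- In both cases the top row of `A` spans the radical of the alternating matrix, so the new
    -- first row vanishes; the second row scales the remaining entry to 1. The bottom row `(0, 0,
    -- 1)` keeps a vanishing last diagonal entry zero.
    refine ⟨!![0, 1, x / y; 1 / y, 0, 0; 0, 0, 1], by simp [Matrix.det_fin_three, hy], rfl, rfl, ?_⟩
    ext i
    fin_cases i <;>
      simp [congrLin_apply, symCoords, symMat, Matrix.mul_apply, Fin.sum_univ_three, hz] <;>
      field_simp
    all_goals first | (ring_nf; done) | (ring_nf; simp [h2])
  · refine ⟨!![z, -y, x; 0, 1 / z, 0; 0, 0, 1], by simp [Matrix.det_fin_three, hz], rfl, rfl, ?_⟩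
    ext i
    fin_cases i <;>
      simp [congrLin_apply, symCoords, symMat, Matrix.mul_apply, Fin.sum_univ_three] <;>
      field_simp
    all_goals first | (ring_nf; done) | (ring_nf; simp [h2])

variable [Finite F]

lemma IsNucleusPointSpace.exists_congruent_last_eq_zero {S : Submodule F (Fin 6 → F)}
    (hS : IsNucleusPointSpace S) : ∃ S', SymCongruent S S' ∧ ∀ v ∈ S', v 5 = 0 := by
  obtain ⟨n, hn, hspan⟩ := hS.exists_span
  have hnS : n ∈ S ⊓ nucleusSubmodule F := hspan ▸ Submodule.mem_span_singleton_self n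
  let d : S →ₗ[F] (Fin 3 → F) := (diagLin F).comp S.subtype
  have hlt : LinearMap.range d < ⊤ := by
    rw [lt_top_iff_ne_top]
    intro htop
    have h1 := LinearMap.finrank_range_add_finrank_ker d
    rw [htop, finrank_top, hS.finrank_eq, Module.finrank_fintype_fun_eq_card,
      Fintype.card_fin] at h1
    have h2 : Module.finrank F (LinearMap.ker d) = 0 := by omega
    rw [Submodule.finrank_eq_zero] at h2
    have : (⟨n, hnS.1⟩ : S) ∈ LinearMap.ker d := by
      obtain ⟨h0, h3, h5⟩ := hnS.2
      rw [LinearMap.mem_ker]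
      change ![n 0, n 3, n 5] = 0
      simp [h0, h3, h5]
    rw [h2, Submodule.mem_bot] at this
    exact hn (congrArg Subtype.val this)
  obtain ⟨f, hf, hle⟩ := Submodule.exists_le_ker_of_lt_top _ hlt
  -- A functional `f` killing all diagonals is to become the new last diagonal entry. That entry has
  -- squared coefficients, so the third row of `A` must consist of the square roots of the
  -- coefficients of `f`.
  choose k hk using fun i : Fin 3 => exists_sq_eq (f (Pi.single i 1))
  have hfx (x : Fin 3 → F) : f x = k 0 ^ 2 * x 0 + k 1 ^ 2 * x 1 + k 2 ^ 2 * x 2 := by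
    rw [hk, hk, hk, LinearMap.pi_apply_eq_sum_univ f x, Fin.sum_univ_three]
    have (i : Fin 3) : (fun j => if i = j then (1 : F) else 0) = Pi.single i 1 := by
      ext j
      simp [Pi.single_apply, eq_comm]
    simp only [this, smul_eq_mul]
    ring
  have hk0 : k ≠ 0 := by
    rintro rfl
    apply hf
    ext1 x
    ext
    simp [hfx]
  obtain ⟨A, hA, hAk⟩ := exists_det_ne_zero_row hk0
  refine ⟨S.map (congrLin A), ⟨A, hA, rfl⟩, ?_⟩
  rintro _ ⟨v, hv, rfl⟩
  have h0 : f (d ⟨v, hv⟩) = 0 := hle ⟨⟨v, hv⟩, rfl⟩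
  rw [hfx] at h0
  rw [(congrLin_diag A v).2.2, hAk]
  exact h0

theorem IsNucleusPointSpace.exists_congruent {S : Submodule F (Fin 6 → F)}
    (hS : IsNucleusPointSpace S) : ∃ α β γ δ : F,
      SymCongruent S (LinearMap.range (planeI α β γ δ)) ∨
      SymCongruent S (LinearMap.range (planeII α β γ δ)) := by
  obtain ⟨S₁, h₁, h5⟩ := hS.exists_congruent_last_eq_zero
  have hS₁ := h₁.isNucleusPointSpace hS
  obtain ⟨n, hn, hspan⟩ := hS₁.exists_span
  obtain ⟨hnS, hn0, hn3, hn5⟩ : n ∈ S₁ ⊓ nucleusSubmodule F :=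
    hspan ▸ Submodule.mem_span_singleton_self n
  by_cases h : n 2 ≠ 0 ∨ n 4 ≠ 0
  · obtain ⟨A, hA, hA0, hA1, hAn⟩ := exists_congrLin_nucleus (n 1) (n 2) (n 4) h
    have hne : n = ![0, n 1, n 2, 0, n 4, 0] := by
      ext i
      fin_cases i <;> simp [hn0, hn3, hn5]
    rw [← hne] at hAn
    have h₂ : SymCongruent S₁ (S₁.map (congrLin A)) := ⟨A, hA, rfl⟩
    obtain ⟨α, β, γ, δ, he⟩ := (h₂.isNucleusPointSpace hS₁).eq_range_planeII (by
      rintro _ ⟨v, hv, rfl⟩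
      rw [(congrLin_diag A v).2.2, hA0, hA1, h5 v hv]
      simp) ⟨n, hnS, hAn⟩
    exact ⟨α, β, γ, δ, .inr (h₁.trans (he ▸ h₂))⟩
  · push Not at h
    have hn1 : n 1 ≠ 0 := by
      intro h1
      apply hn
      ext i
      fin_cases i <;> simp [hn0, h1, hn3, hn5, h.1, h.2]
    obtain ⟨α, β, γ, δ, he⟩ := hS₁.eq_range_planeI h5 (by
      have := S₁.smul_mem (n 1)⁻¹ hnS
      convert this using 1
      ext i
      fin_cases i <;> simp [hn0, hn1, hn3, hn5, h.1, h.2])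
    exact ⟨α, β, γ, δ, .inl (he ▸ h₁)⟩

end Reduction

/-! ### The second family -/

lemma veroneseVec_mem_range_planeI {α β γ δ : F} {u : Fin 3 → F} :
    veroneseVec u ∈ LinearMap.range (planeI α β γ δ) ↔ u 0 * u 2 = α * u 0 ^ 2 + β * u 1 ^ 2 ∧
      u 1 * u 2 = γ * u 0 ^ 2 + δ * u 1 ^ 2 ∧ u 2 = 0 := by
  rw [mem_range_planeI]
  simp [veroneseVec]

lemma veroneseVec_mem_range_planeII {α β γ δ : F} {u : Fin 3 → F} :
    veroneseVec u ∈ LinearMap.range (planeII α β γ δ) ↔ u 0 * u 1 = α * u 0 ^ 2 + β * u 1 ^ 2 ∧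
      u 0 * u 2 = γ * u 0 ^ 2 + δ * u 1 ^ 2 ∧ u 2 = 0 := by
  rw [mem_range_planeII]
  simp [veroneseVec]

lemma isNucleusPointSpace_planeII {α β γ δ : F}
    (h : ∀ x y : F, x * y = α * x ^ 2 + β * y ^ 2 → γ * x ^ 2 + δ * y ^ 2 = 0 → x = 0 ∧ y = 0) :
    IsNucleusPointSpace (LinearMap.range (planeII α β γ δ)) := by
  refine ⟨finrank_range_planeII α β γ δ, fun u hu hmem => hu ?_, ![0, 0, 0, 0, 1, 0], ?_, ?_⟩
  · obtain ⟨h1, h2, h3⟩ := veroneseVec_mem_range_planeII.mp hmem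
    rw [h3, mul_zero] at h2
    obtain ⟨h0, h1⟩ := h _ _ h1 h2.symm
    ext i
    fin_cases i <;> assumption
  · intro h0
    simpa using congrFun h0 4
  · ext v
    rw [Submodule.mem_inf, mem_range_planeII, mem_nucleusSubmodule, Submodule.mem_span_singleton]
    constructor
    · rintro ⟨⟨h1, h2, -⟩, h0, h3, h5⟩
      refine ⟨v 4, ?_⟩
      ext i
      fin_cases i <;> simp [h0, h1, h2, h3, h5]
    · rintro ⟨c, rfl⟩
      simp

lemma isNucleusPointSpace_planeI {α β γ δ : F} (h : α * δ - β * γ ≠ 0) :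
    IsNucleusPointSpace (LinearMap.range (planeI α β γ δ)) := by
  refine ⟨finrank_range_planeI α β γ δ, fun u hu hmem => hu ?_, ![0, 1, 0, 0, 0, 0], ?_, ?_⟩
  · obtain ⟨h1, h2, h3⟩ := veroneseVec_mem_range_planeI.mp hmem
    rw [h3, mul_zero] at h1 h2
    have e0 : (α * δ - β * γ) * u 0 ^ 2 = 0 := by linear_combination β * h2 - δ * h1
    have e1 : (α * δ - β * γ) * u 1 ^ 2 = 0 := by linear_combination γ * h1 - α * h2
    simp only [mul_eq_zero, h, pow_eq_zero_iff two_ne_zero, false_or] at e0 e1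
    ext i
    fin_cases i <;> assumption
  · intro h0
    simpa using congrFun h0 1
  · ext v
    rw [Submodule.mem_inf, mem_range_planeI, mem_nucleusSubmodule, Submodule.mem_span_singleton]
    constructor
    · rintro ⟨⟨h1, h2, -⟩, h0, h3, h5⟩
      refine ⟨v 1, ?_⟩
      ext i
      fin_cases i <;> simp [h0, h1, h2, h3, h5]
    · rintro ⟨c, rfl⟩
      simp

section SecondFamily

variable [CharP F 2]

/-- The congruence matrix has rows `(x, 0, 0)`, `(y, z, w)`, `(0, 0, s)`. The four equations compare
the coefficients of the parameters `v 0` and `v 1` in the two equations of the target plane; `v 2`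
does not enter them. -/
lemma congruent_planeII {α β γ δ α' β' γ' δ' : F} (x y z w s : F)
    (hx : x ≠ 0) (hz : z ≠ 0) (hs : s ≠ 0)
    (h1 : x * (y + z * α + w * γ) = α' * x ^ 2 + β' * y ^ 2)
    (h2 : x * (z * β + w * δ) = β' * z ^ 2)
    (h3 : x * s * γ = γ' * x ^ 2 + δ' * y ^ 2)
    (h4 : x * s * δ = δ' * z ^ 2) :
    SymCongruent (LinearMap.range (planeII α β γ δ)) (LinearMap.range (planeII α' β' γ' δ')) := by
  refine congruent_of_le !![x, 0, 0; y, z, w; 0, 0, s] ?_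
    ((finrank_range_planeII _ _ _ _).trans (finrank_range_planeII _ _ _ _).symm) ?_
  · simp [Matrix.det_fin_three, hx, hz, hs]
  · rintro _ ⟨v, rfl⟩
    obtain ⟨e0, e3, e5⟩ := congrLin_diag !![x, 0, 0; y, z, w; 0, 0, s] (planeII α β γ δ v)
    rw [mem_range_planeII, e0, e3, e5]
    simp [congrLin_apply, symCoords, symMat, Matrix.mul_apply, Fin.sum_univ_three, planeII_apply]
    constructor
    · linear_combination v 0 * h1 + v 1 * h2
    · linear_combination v 0 * h3 + v 1 * h4

variable [Finite F]

/-- The map `x² + x` takes the same value at 0 and 1, so on a finite field it is not surjective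
either. -/
lemma exists_forall_sq_add_self_add_ne_zero (F : Type u) [Field F] [CharP F 2] [Finite F] :
    ∃ e : F, ∀ x : F, x ^ 2 + x + e ≠ 0 := by
  by_contra! h
  have hsurj : Function.Surjective fun x : F => x ^ 2 + x := fun e => by
    obtain ⟨x, hx⟩ := h e
    exact ⟨x, CharTwo.add_eq_zero.mp hx⟩
  have hinj := Finite.injective_iff_surjective.mpr hsurj
  have : (0 : F) = 1 := hinj (by simp [CharTwo.add_self_eq_zero])
  exact zero_ne_one this

/-- The Artin–Schreier map. -/
def artinSchreier (F : Type u) [Field F] [CharP F 2] : F →+ F where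
  toFun x := x ^ 2 + x
  map_zero' := by simp
  map_add' x y := by
    rw [add_sq_char_two]
    ring

lemma index_range_artinSchreier (F : Type u) [Field F] [CharP F 2] [Finite F] :
    (artinSchreier F).range.index = 2 := by
  have hker : Nat.card (artinSchreier F).ker = 2 := by
    have : ((artinSchreier F).ker : Set F) = {0, 1} := by
      ext x
      change x ^ 2 + x = 0 ↔ x = 0 ∨ x = 1
      rw [show x ^ 2 + x = x * (x + 1) by ring, mul_eq_zero, CharTwo.add_eq_zero (b := 1)]
    rw [← SetLike.coe_sort_coe, this, Nat.card_coe_set_eq, Set.ncard_pair zero_ne_one]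
  have h1 := (artinSchreier F).range.card_mul_index
  have h2 := (artinSchreier F).ker.card_mul_index
  rw [AddSubgroup.index_ker, hker, ← h1, mul_comm] at h2
  exact (Nat.eq_of_mul_eq_mul_left Nat.card_pos h2).symm

/-- Two elements outside a subgroup of index 2 have their sum inside it. This is why each family
with an irreducible `x² + x + e` is a single orbit. -/
lemma exists_sq_add_self_eq_add {e e' : F} (h : ∀ x : F, x ^ 2 + x + e ≠ 0)
    (h' : ∀ x : F, x ^ 2 + x + e' ≠ 0) : ∃ y : F, y ^ 2 + y = e + e' := by
  have key {e : F} (h : ∀ x : F, x ^ 2 + x + e ≠ 0) : e ∉ (artinSchreier F).range := by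
    rintro ⟨x, hx⟩
    exact h x (CharTwo.add_eq_zero.mpr hx)
  exact (AddSubgroup.add_mem_iff_of_index_two (index_range_artinSchreier F)).mpr
    (iff_of_false (key h) (key h'))

lemma congruent_planeII_of_forall_ne_zero {e e' : F} (h : ∀ x : F, x ^ 2 + x + e ≠ 0)
    (h' : ∀ x : F, x ^ 2 + x + e' ≠ 0) :
    SymCongruent (LinearMap.range (planeII e 1 0 0)) (LinearMap.range (planeII e' 1 0 0)) := by
  obtain ⟨y, hy⟩ := exists_sq_add_self_eq_add h h'
  refine congruent_planeII 1 y 1 0 1 one_ne_zero one_ne_zero one_ne_zero ?_ ?_ ?_ ?_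
  · have h2 : (2 : F) = 0 := CharTwo.two_eq_zero
    linear_combination -hy + (y - e') * h2
  all_goals simp

theorem congruent_of_planeII {α β γ δ : F}
    (h : IsNucleusPointSpace (LinearMap.range (planeII α β γ δ))) :
    SymCongruent (LinearMap.range (planeII α β γ δ)) (LinearMap.range (planeII (1 : F) 0 0 1)) ∨
    SymCongruent (LinearMap.range (planeII α β γ δ)) (LinearMap.range (planeII (0 : F) 1 1 0)) ∨
    ∃ e : F, (∀ x : F, x ^ 2 + x + e ≠ 0) ∧
      SymCongruent (LinearMap.range (planeII α β γ δ)) (LinearMap.range (planeII e 1 0 0)) := by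
  have h2 : (2 : F) = 0 := CharTwo.two_eq_zero
  have hv (x y : F) (h1 : x * y = α * x ^ 2 + β * y ^ 2) (h2 : γ * x ^ 2 + δ * y ^ 2 = 0) :
      x = 0 ∧ y = 0 := by
    by_contra hne
    refine h.veroneseVec_notMem ![x, y, 0] (fun h0 => hne ⟨congrFun h0 0, congrFun h0 1⟩) ?_
    rw [veroneseVec_mem_range_planeII]
    simp [h1, h2]
  by_cases hδ : δ = 0
  · subst hδ
    have hβ : β ≠ 0 := by
      rintro rfl
      exact one_ne_zero (hv 0 1 (by simp) (by simp)).2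
    by_cases hγ : γ = 0
    · subst hγ
      -- A root `r` of `x² + x + αβ` would put the Veronese point of `(1, r/β, 0)` into the plane.
      refine .inr (.inr ⟨α * β, fun r hr => ?_, ?_⟩)
      · refine one_ne_zero (hv 1 (r / β) ?_ (by simp)).1
        field_simp
        linear_combination hr - r ^ 2 * h2 - α * β * h2
      · refine congruent_planeII 1 0 β 0 1 one_ne_zero hβ one_ne_zero ?_ ?_ ?_ ?_ <;> ring
    · refine .inr (.inl (congruent_planeII 1 0 β (-β * α / γ) (1 / γ) one_ne_zero hβ
        (one_div_ne_zero hγ) ?_ ?_ ?_ ?_)) <;> field_simp <;> ring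
  -- This `y` makes `γ + δy²` vanish in characteristic 2. If `κ` below were zero, the Veronese point
  -- of `(1, y, 0)` would lie in the plane. The other entries of the congruence are solved from the
  -- four equations: `w` removes `β` and `s` normalises `δ`.
  · obtain ⟨y, hy⟩ := exists_sq_eq (γ / δ)
    have hy' : δ * y ^ 2 = γ := by
      rw [hy]
      field_simp
    have hκ : y - α - β * y ^ 2 ≠ 0 := by
      intro h0
      refine one_ne_zero (hv 1 y ?_ ?_).1
      · linear_combination h0
      · linear_combination hy' + γ * h2
    obtain ⟨κ, hκ'⟩ : ∃ κ, κ = y - α - β * y ^ 2 := ⟨_, rfl⟩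
    rw [← hκ'] at hκ
    refine .inl (congruent_planeII κ y 1 (-β / δ) (1 / (κ * δ))
      hκ one_ne_zero (one_div_ne_zero (mul_ne_zero hκ hδ)) ?_ ?_ ?_ ?_)
    · rw [← hy']
      field_simp
      linear_combination κ * α * h2 - κ * hκ'
    · field_simp
      ring
    · rw [← hy']
      field_simp
      ring
    · field_simp

end SecondFamily

/-! ### The first family -/

/-- A kernel vector of `T` has square coordinates `(x², y²)`, and then the Veronese point of `(x, y,
0)` lies in the plane. If the determinant vanished, the columns of the adjugate would be kernel
vectors, forcing `T = 0`, for which every vector is in the kernel. -/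
lemma IsNucleusPointSpace.det_ne_zero [CharP F 2] [Finite F] {α β γ δ : F}
    (h : IsNucleusPointSpace (LinearMap.range (planeI α β γ δ))) : α * δ - β * γ ≠ 0 := by
  intro hD
  have hv (a b : F) (h1 : α * a + β * b = 0) (h2 : γ * a + δ * b = 0) : a = 0 ∧ b = 0 := by
    obtain ⟨x, rfl⟩ := exists_sq_eq a
    obtain ⟨y, rfl⟩ := exists_sq_eq b
    by_contra hne
    refine h.veroneseVec_notMem ![x, y, 0] (fun h0 => hne ?_) ?_
    · rw [show x = 0 from congrFun h0 0, show y = 0 from congrFun h0 1]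
      simp
    · rw [veroneseVec_mem_range_planeI]
      simp [h1, h2]
  obtain ⟨hδ, hγ⟩ := hv δ (-γ) (by linear_combination hD) (by ring)
  obtain ⟨hβ, hα⟩ := hv β (-α) (by ring) (by linear_combination -hD)
  rw [neg_eq_zero] at hγ hα
  exact one_ne_zero (hv 1 0 (by simp [hα]) (by simp [hγ])).1

/-- With `B` having rows `(p, q)` and `(r, w)`, the hypotheses are the entries of `B T = T' B⁽²⁾`,
and the congruence is by `diag(B, 1)`. -/
lemma congruent_planeI [CharP F 2] {α β γ δ α' β' γ' δ' : F} (p q r w : F)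
    (hdet : p * w - q * r ≠ 0)
    (h1 : p * α + q * γ = α' * p ^ 2 + β' * r ^ 2)
    (h2 : p * β + q * δ = α' * q ^ 2 + β' * w ^ 2)
    (h3 : r * α + w * γ = γ' * p ^ 2 + δ' * r ^ 2)
    (h4 : r * β + w * δ = γ' * q ^ 2 + δ' * w ^ 2) :
    SymCongruent (LinearMap.range (planeI α β γ δ)) (LinearMap.range (planeI α' β' γ' δ')) := by
  refine congruent_of_le !![p, q, 0; r, w, 0; 0, 0, 1] ?_
    ((finrank_range_planeI _ _ _ _).trans (finrank_range_planeI _ _ _ _).symm) ?_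
  · simpa [Matrix.det_fin_three] using hdet
  · rintro _ ⟨v, rfl⟩
    obtain ⟨e0, e3, e5⟩ := congrLin_diag !![p, q, 0; r, w, 0; 0, 0, 1] (planeI α β γ δ v)
    rw [mem_range_planeI, e0, e3, e5]
    simp [congrLin_apply, symCoords, symMat, Matrix.mul_apply, Fin.sum_univ_three, planeI_apply]
    constructor
    · linear_combination v 0 * h1 + v 1 * h2
    · linear_combination v 0 * h3 + v 1 * h4

/-- `w = (x, y)` satisfies `T w⁽²⁾ = w`, where `T` has the rows `(α, β)` and `(γ, δ)` and `w⁽²⁾` is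
the entrywise square. -/
def IsFixedVector {E : Type*} [Field E] (α β γ δ x y : E) : Prop :=
  α * x ^ 2 + β * y ^ 2 = x ∧ γ * x ^ 2 + δ * y ^ 2 = y

/-- The hypothesis says that `T w⁽²⁾` is parallel to `w`, say `T w⁽²⁾ = l w`. Here `l ≠ 0` because
`T` is invertible, and `l⁻¹ w` is fixed since the left side scales quadratically. Zeros of the cubic
thus become fixed vectors. -/
lemma exists_isFixedVector {E : Type*} [Field E] {α β γ δ x y : E} (hD : α * δ - β * γ ≠ 0)
    (hne : ¬(x = 0 ∧ y = 0))
    (h : x * (γ * x ^ 2 + δ * y ^ 2) = y * (α * x ^ 2 + β * y ^ 2)) :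
    ∃ c : E, c ≠ 0 ∧ IsFixedVector α β γ δ (c * x) (c * y) := by
  obtain ⟨l, hx, hy⟩ : ∃ l, α * x ^ 2 + β * y ^ 2 = l * x ∧ γ * x ^ 2 + δ * y ^ 2 = l * y := by
    by_cases hx : x = 0
    · have hy : y ≠ 0 := fun hy => hne ⟨hx, hy⟩
      refine ⟨(γ * x ^ 2 + δ * y ^ 2) / y, ?_, ?_⟩ <;> field_simp
      linear_combination -h
    · refine ⟨(α * x ^ 2 + β * y ^ 2) / x, ?_, ?_⟩ <;> field_simp
      linear_combination h
  have hl : l ≠ 0 := by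
    rintro rfl
    apply hne
    have e0 : (α * δ - β * γ) * x ^ 2 = 0 := by linear_combination δ * hx - β * hy
    have e1 : (α * δ - β * γ) * y ^ 2 = 0 := by linear_combination α * hy - γ * hx
    simpa only [mul_eq_zero, hD, pow_eq_zero_iff two_ne_zero, false_or] using And.intro e0 e1
  refine ⟨l⁻¹, inv_ne_zero hl, ?_, ?_⟩ <;> field_simp
  · linear_combination hx
  · linear_combination hy

section FirstFamily

variable [CharP F 2]

lemma congruent_planeI_one {e x : F} (h : x ^ 2 + x + e = 0) :
    SymCongruent (LinearMap.range (planeI 1 e 0 1)) (LinearMap.range (planeI (1 : F) 0 0 1)) := by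
  have h2 : (2 : F) = 0 := CharTwo.two_eq_zero
  refine (congruent_planeI 1 x 0 1 (by simp) ?_ ?_ ?_ ?_).symm
  · ring
  · linear_combination -h + x * h2
  · ring
  · ring

variable [Finite F]

lemma congruent_planeI_of_forall_ne_zero {e e' : F} (h : ∀ x : F, x ^ 2 + x + e ≠ 0)
    (h' : ∀ x : F, x ^ 2 + x + e' ≠ 0) :
    SymCongruent (LinearMap.range (planeI 1 e 0 1)) (LinearMap.range (planeI 1 e' 0 1)) := by
  obtain ⟨y, hy⟩ := exists_sq_add_self_eq_add h h'
  have h2 : (2 : F) = 0 := CharTwo.two_eq_zero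
  refine congruent_planeI 1 y 0 1 (by simp) ?_ ?_ ?_ ?_
  · ring
  · linear_combination -hy + (y - e') * h2
  · ring
  · ring

/-- Taking the fixed vector as first column of `B` turns the first column of the twisted conjugate
into `(1, 0)`; a diagonal scaling then makes the last entry 1. -/
lemma congruent_of_isFixedVector {α β γ δ p r : F}
    (h : IsNucleusPointSpace (LinearMap.range (planeI α β γ δ))) (hne : ¬(p = 0 ∧ r = 0))
    (hpr : IsFixedVector α β γ δ p r) :
    ∃ e : F, SymCongruent (LinearMap.range (planeI α β γ δ)) (LinearMap.range (planeI 1 e 0 1)) := by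
  obtain ⟨q, w, hdet⟩ : ∃ q w, p * w - q * r ≠ 0 := by
    by_cases hp : p = 0
    · exact ⟨1, 0, by simpa using fun hr => hne ⟨hp, hr⟩⟩
    · exact ⟨0, 1, by simpa using hp⟩
  -- By Cramer's rule `b` and `d` are the coordinates of `T (q, w)⁽²⁾` in the basis `(p, r)`, `(q,
  -- w)`.
  obtain ⟨b, hb⟩ : ∃ b, b = ((α * q ^ 2 + β * w ^ 2) * w - q * (γ * q ^ 2 + δ * w ^ 2)) /
    (p * w - q * r) := ⟨_, rfl⟩
  obtain ⟨d, hd⟩ : ∃ d, d = (p * (γ * q ^ 2 + δ * w ^ 2) - (α * q ^ 2 + β * w ^ 2) * r) /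
    (p * w - q * r) := ⟨_, rfl⟩
  rw [eq_div_iff hdet] at hb hd
  have h1 : SymCongruent (LinearMap.range (planeI 1 b 0 d)) (LinearMap.range (planeI α β γ δ)) := by
    refine congruent_planeI p q r w hdet ?_ ?_ ?_ ?_
    · linear_combination -hpr.1
    · apply mul_right_cancel₀ hdet
      linear_combination p * hb + q * hd
    · linear_combination -hpr.2
    · apply mul_right_cancel₀ hdet
      linear_combination r * hb + w * hd
  have hd0 : d ≠ 0 := by
    have := (h1.symm.isNucleusPointSpace h).det_ne_zero
    simpa using this
  refine ⟨b / d ^ 2, h1.symm.trans (congruent_planeI 1 0 0 d (by simpa using hd0) ?_ ?_ ?_ ?_)⟩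
  · ring
  · field_simp
    ring
  · ring
  · ring

end FirstFamily

/-! ### The cubic extension -/

section CubicExtension

variable (F) [CharP F 2] [Finite F]

/-- The extension of degree three of a finite field of characteristic two. -/
abbrev CubicExt : Type := FiniteField.Extension F 2 3

variable {F}

instance : CharP (CubicExt F) 2 := charP_of_injective_algebraMap (algebraMap F _).injective 2

lemma algebraMap_trace_cubicExt (z : CubicExt F) :
    algebraMap F (CubicExt F) (Algebra.trace F (CubicExt F) z) =
      ∑ σ : Gal(CubicExt F/F), σ z :=
  trace_eq_sum_automorphisms z

lemma trace_sq_cubicExt (z : CubicExt F) :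
    Algebra.trace F (CubicExt F) (z ^ 2) = Algebra.trace F (CubicExt F) z ^ 2 := by
  apply (algebraMap F (CubicExt F)).injective
  rw [RingHom.map_pow, algebraMap_trace_cubicExt, algebraMap_trace_cubicExt, CharTwo.sum_sq]
  simp

/-- The degree 3 is odd, so `3c = c`. In particular a nonzero element of `F` never has trace zero,
which is what the later contradictions use. -/
lemma trace_algebraMap_cubicExt (c : F) :
    Algebra.trace F (CubicExt F) (algebraMap F _ c) = c := by
  rw [Algebra.trace_algebraMap, FiniteField.finrank_extension]
  have h2 : (2 : F) = 0 := CharTwo.two_eq_zero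
  rw [nsmul_eq_mul]
  push_cast
  linear_combination c * h2

lemma finrank_ker_trace_cubicExt :
    Module.finrank F (LinearMap.ker (Algebra.trace F (CubicExt F))) = 2 := by
  have h := LinearMap.finrank_range_add_finrank_ker (Algebra.trace F (CubicExt F))
  rw [LinearMap.range_eq_top.mpr fun c => ⟨_, trace_algebraMap_cubicExt c⟩,
    FiniteField.finrank_extension, finrank_top, Module.finrank_self] at h
  omega

lemma exists_eq_smul_add_smul {x y z : CubicExt F} (h : LinearIndependent F ![x, y])
    (hx : Algebra.trace F (CubicExt F) x = 0) (hy : Algebra.trace F (CubicExt F) y = 0)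
    (hz : Algebra.trace F (CubicExt F) z = 0) : ∃ c d : F, z = c • x + d • y := by
  have hle : Submodule.span F {x, y} ≤ LinearMap.ker (Algebra.trace F (CubicExt F)) := by
    rw [Submodule.span_le]
    rintro _ (rfl | rfl)
    · exact hx
    · exact hy
  have heq := Submodule.eq_of_le_of_finrank_eq hle (by
    have := finrank_span_eq_card h
    rw [finrank_ker_trace_cubicExt]
    rw [Matrix.range_cons_cons_empty] at this
    simpa using this)
  have hmem : z ∈ Submodule.span F {x, y} := heq ▸ hz
  obtain ⟨c, d, h⟩ := Submodule.mem_span_pair.mp hmem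
  exact ⟨c, d, h.symm⟩

/-- Coefficients in `F` are squares, so a relation between squares is the square of a relation. -/
lemma linearIndependent_sq {x y : CubicExt F} (h : LinearIndependent F ![x, y]) :
    LinearIndependent F ![x ^ 2, y ^ 2] := by
  rw [LinearIndependent.pair_iff] at h ⊢
  intro c d hcd
  obtain ⟨c, rfl⟩ := exists_sq_eq c
  obtain ⟨d, rfl⟩ := exists_sq_eq d
  have : (c • x + d • y) ^ 2 = 0 := by
    rw [add_sq_char_two, smul_pow, smul_pow, hcd]
  obtain ⟨rfl, rfl⟩ := h c d (pow_eq_zero_iff two_ne_zero |>.mp this)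
  simp

/-- `v = (x, y)` has trace zero, independent coordinates, and satisfies `T v⁽²⁾ = v`. -/
structure IsCubicFixedVector (α β γ δ : F) (x y : CubicExt F) : Prop where
  linearIndependent : LinearIndependent F ![x, y]
  trace_fst : Algebra.trace F (CubicExt F) x = 0
  trace_snd : Algebra.trace F (CubicExt F) y = 0
  fst_eq : α • x ^ 2 + β • y ^ 2 = x
  snd_eq : γ • x ^ 2 + δ • y ^ 2 = y

-- Setting `w = (t, 1)` in the parallelism condition gives a cubic in `t`. Since there are no
-- rational solutions its leading coefficient is nonzero and it has no root in `F`, hence it is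
-- irreducible and splits off a root in the extension of degree 3.
open Polynomial in
lemma exists_root_cubicExt {α β γ δ : F}
    (hroot : ∀ x y : F, x * (γ * x ^ 2 + δ * y ^ 2) = y * (α * x ^ 2 + β * y ^ 2) →
      x = 0 ∧ y = 0) :
    ∃ t : CubicExt F, t * (γ • t ^ 2 + δ • 1) = α • t ^ 2 + β • 1 := by
  have hγ : γ ≠ 0 := by
    rintro rfl
    exact one_ne_zero (hroot 1 0 (by simp)).1
  let p : F[X] := C γ * X ^ 3 + C (-α) * X ^ 2 + C δ * X + C (-β)
  have hdeg : p.natDegree = 3 := natDegree_cubic hγ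
  have hirr : Irreducible p := by
    refine irreducible_of_degree_le_three_of_not_isRoot (by simp [hdeg]) fun x hx => ?_
    refine one_ne_zero (hroot x 1 ?_).2
    have : γ * x ^ 3 + -α * x ^ 2 + δ * x + -β = 0 := by simpa [p, IsRoot] using hx
    linear_combination this
  have : Fact (Irreducible p) := ⟨hirr⟩
  have hfin : Module.finrank F (AdjoinRoot p) = 3 := by
    rw [(AdjoinRoot.powerBasis hirr.ne_zero).finrank, AdjoinRoot.powerBasis_dim, hdeg]
  let φ := FiniteField.algEquivExtension F 2 3 (AdjoinRoot p) hfin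
  refine ⟨φ (AdjoinRoot.root p), ?_⟩
  have h0 : aeval (φ (AdjoinRoot.root p)) p = 0 := by
    rw [aeval_algHom_apply, AdjoinRoot.aeval_eq, AdjoinRoot.mk_self, map_zero]
  simp only [p, map_add, map_mul, map_pow, aeval_C, aeval_X, map_neg] at h0
  simp only [Algebra.smul_def, mul_one]
  linear_combination h0

lemma exists_isCubicFixedVector {α β γ δ : F} (hD : α * δ - β * γ ≠ 0)
    (hfix : ∀ x y : F, IsFixedVector α β γ δ x y → x = 0 ∧ y = 0) :
    ∃ x y : CubicExt F, IsCubicFixedVector α β γ δ x y := by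
  obtain ⟨t, ht⟩ := exists_root_cubicExt (α := α) (β := β) (γ := γ) (δ := δ) (by
    intro x y h
    by_contra hne
    obtain ⟨c, hc, hcf⟩ := exists_isFixedVector hD hne h
    exact hne (by simpa [hc] using hfix _ _ hcf))
  obtain ⟨c, hc, hx, hy⟩ := exists_isFixedVector (E := CubicExt F) (x := t) (y := 1)
    (α := algebraMap F _ α) (β := algebraMap F _ β) (γ := algebraMap F _ γ)
    (δ := algebraMap F _ δ) (by
      simpa only [← map_mul, ← map_sub, Ne, map_eq_zero] using hD) (by simp) (by
      simpa [Algebra.smul_def] using ht)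
  simp only [← Algebra.smul_def, mul_one] at hx hy
  -- The trace commutes with squaring, so the trace of a fixed vector is a fixed vector over `F`,
  -- and only zero is available.
  have htr : Algebra.trace F (CubicExt F) (c * t) = 0 ∧ Algebra.trace F (CubicExt F) c = 0 := by
    refine hfix _ _ ⟨?_, ?_⟩
    · simpa [trace_sq_cubicExt] using congrArg (Algebra.trace F (CubicExt F)) hx
    · simpa [trace_sq_cubicExt] using congrArg (Algebra.trace F (CubicExt F)) hy
  refine ⟨c * t, c, ?_, htr.1, htr.2, hx, hy⟩
  rw [LinearIndependent.pair_iff]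
  intro a b hab
  -- Dependent coordinates would put `t` in `F`; the second fixed-vector equation then puts `c` in
  -- `F` as well, contradicting that it is nonzero of trace zero.
  have ha : a = 0 := by
    by_contra ha
    obtain ⟨s, hs⟩ : ∃ s : F, t = algebraMap F _ s := by
      refine ⟨-b / a, ?_⟩
      rw [map_div₀, eq_div_iff (by simpa using ha)]
      apply mul_left_cancel₀ hc
      simp only [Algebra.smul_def] at hab
      rw [map_neg]
      linear_combination hab
    have hy' : c * algebraMap F _ (γ * s ^ 2 + δ) = 1 := by
      apply mul_left_cancel₀ hc
      simp only [Algebra.smul_def, hs] at hy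
      simp only [map_add, map_mul, map_pow]
      linear_combination hy
    have hne : γ * s ^ 2 + δ ≠ 0 := by
      intro h0
      simp [h0] at hy'
    have hc' : c = algebraMap F _ (γ * s ^ 2 + δ)⁻¹ := by
      rw [map_inv₀]
      exact eq_inv_of_mul_eq_one_left hy'
    have := htr.2
    rw [hc', trace_algebraMap_cubicExt] at this
    exact inv_ne_zero hne this
  refine ⟨ha, ?_⟩
  rw [ha, zero_smul, zero_add, smul_eq_zero] at hab
  exact hab.resolve_right hc

/-- The coordinates of `v` and of `v'` are bases of the same trace-zero plane over `F`, so `v' = B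
v`. Then `T' B⁽²⁾ v⁽²⁾ = B v = B T v⁽²⁾`, and the independence of `x²`, `y²` gives `T' B⁽²⁾ = B T`.
-/
lemma IsCubicFixedVector.congruent {α β γ δ α' β' γ' δ' : F} {x y x' y' : CubicExt F}
    (h : IsCubicFixedVector α β γ δ x y) (h' : IsCubicFixedVector α' β' γ' δ' x' y') :
    SymCongruent (LinearMap.range (planeI α β γ δ)) (LinearMap.range (planeI α' β' γ' δ')) := by
  obtain ⟨p, q, hpq⟩ :=
    exists_eq_smul_add_smul h.linearIndependent h.trace_fst h.trace_snd h'.trace_fst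
  obtain ⟨r, w, hrw⟩ :=
    exists_eq_smul_add_smul h.linearIndependent h.trace_fst h.trace_snd h'.trace_snd
  have key {a b c d : F} (hab : a • x ^ 2 + b • y ^ 2 = c • x ^ 2 + d • y ^ 2) : a = c ∧ b = d := by
    have := LinearIndependent.pair_iff.mp (linearIndependent_sq h.linearIndependent) (a - c) (b - d)
      (by
        rw [sub_smul, sub_smul]
        linear_combination hab)
    exact ⟨sub_eq_zero.mp this.1, sub_eq_zero.mp this.2⟩
  have hx := h.fst_eq
  have hy := h.snd_eq
  have hx' := h'.fst_eq
  have hy' := h'.snd_eq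
  have ex : x' ^ 2 = p ^ 2 • x ^ 2 + q ^ 2 • y ^ 2 := by
    rw [hpq, add_sq_char_two, smul_pow, smul_pow]
  have ey : y' ^ 2 = r ^ 2 • x ^ 2 + w ^ 2 • y ^ 2 := by
    rw [hrw, add_sq_char_two, smul_pow, smul_pow]
  simp only [Algebra.smul_def] at hx hy hx' hy' ex ey hpq hrw
  obtain ⟨h1, h2⟩ := key (a := p * α + q * γ) (b := p * β + q * δ)
    (c := α' * p ^ 2 + β' * r ^ 2) (d := α' * q ^ 2 + β' * w ^ 2) (by
      simp only [Algebra.smul_def, map_add, map_mul, map_pow] at ex ey ⊢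
      linear_combination algebraMap F _ p * hx + algebraMap F _ q * hy - hpq - hx' +
        algebraMap F _ α' * ex + algebraMap F _ β' * ey)
  obtain ⟨h3, h4⟩ := key (a := r * α + w * γ) (b := r * β + w * δ)
    (c := γ' * p ^ 2 + δ' * r ^ 2) (d := γ' * q ^ 2 + δ' * w ^ 2) (by
      simp only [Algebra.smul_def, map_add, map_mul, map_pow] at ex ey ⊢
      linear_combination algebraMap F _ r * hx + algebraMap F _ w * hy - hrw - hy' +
        algebraMap F _ γ' * ex + algebraMap F _ δ' * ey)
  refine congruent_planeI p q r w (fun hdet => ?_) h1 h2 h3 h4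
  have hd := congrArg (algebraMap F (CubicExt F)) hdet
  rw [map_sub, map_mul, map_mul, map_zero] at hd
  have hli := LinearIndependent.pair_iff.mp h'.linearIndependent
  have e1 := hli w (-q) (by
    simp only [Algebra.smul_def, map_neg]
    linear_combination algebraMap F _ w * hpq - algebraMap F _ q * hrw + x * hd)
  have e2 := hli r (-p) (by
    simp only [Algebra.smul_def, map_neg]
    linear_combination algebraMap F _ r * hpq - algebraMap F _ p * hrw - y * hd)
  refine h'.linearIndependent.ne_zero 0 ?_
  rw [neg_eq_zero] at e1 e2
  simp [hpq, e1.2, e2.2]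

lemma exists_linearIndependent_trace_eq_zero (F : Type u) [Field F] [CharP F 2] [Finite F] :
    ∃ x y : CubicExt F, LinearIndependent F ![x, y] ∧ Algebra.trace F (CubicExt F) x = 0 ∧
      Algebra.trace F (CubicExt F) y = 0 := by
  let b := Module.finBasisOfFinrankEq F _ (finrank_ker_trace_cubicExt (F := F))
  refine ⟨b 0, b 1, ?_, (b 0).2, (b 1).2⟩
  have := b.linearIndependent.map' (Submodule.subtype _) (Submodule.ker_subtype _)
  convert! this using 1
  ext i
  fin_cases i <;> rfl

/-- If `x`, `y` is a basis of the trace-zero elements, so is `x²`, `y²`; let `T` express the first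
basis in the second. Then `(x, y)` is fixed by construction, and a rational fixed vector is excluded
by a determinant argument. -/
theorem exists_planeI_forall_isFixedVector (F : Type u) [Field F] [CharP F 2] [Finite F] :
    ∃ α β γ δ : F, α * δ - β * γ ≠ 0 ∧
      ∀ x y : F, IsFixedVector α β γ δ x y → x = 0 ∧ y = 0 := by
  obtain ⟨x, y, hli, hx, hy⟩ := exists_linearIndependent_trace_eq_zero F
  have htr (z : CubicExt F) (hz : Algebra.trace F (CubicExt F) z = 0) :
      Algebra.trace F (CubicExt F) (z ^ 2) = 0 := by
    rw [trace_sq_cubicExt, hz, sq, mul_zero]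
  obtain ⟨α, β, e1⟩ := exists_eq_smul_add_smul (linearIndependent_sq hli) (htr x hx) (htr y hy) hx
  obtain ⟨γ, δ, e2⟩ := exists_eq_smul_add_smul (linearIndependent_sq hli) (htr x hx) (htr y hy) hy
  have hli' := LinearIndependent.pair_iff.mp hli
  have h2 : (2 : CubicExt F) = 0 := CharTwo.two_eq_zero
  simp only [Algebra.smul_def] at e1 e2 hli'
  have hD : α * δ - β * γ ≠ 0 := by
    intro h0
    have hd := congrArg (algebraMap F (CubicExt F)) h0
    rw [map_sub, map_mul, map_mul, map_zero] at hd
    have f1 := hli' δ (-β) (by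
      rw [map_neg]
      linear_combination algebraMap F _ δ * e1 - algebraMap F _ β * e2 + x ^ 2 * hd)
    have f2 := hli' γ (-α) (by
      rw [map_neg]
      linear_combination algebraMap F _ γ * e1 - algebraMap F _ α * e2 - y ^ 2 * hd)
    refine hli.ne_zero 0 ?_
    rw [neg_eq_zero] at f1 f2
    rw [f1.2, f2.2, map_zero, zero_mul, zero_mul, add_zero] at e1
    exact e1
  refine ⟨α, β, γ, δ, hD, fun a b ⟨ha, hb⟩ => ?_⟩
  have ha' := congrArg (algebraMap F (CubicExt F)) ha
  have hb' := congrArg (algebraMap F (CubicExt F)) hb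
  simp only [map_add, map_mul, map_pow] at ha' hb'
  by_contra hne
  have hΔ : b • x - a • y ≠ 0 := by
    intro h0
    have := hli' b (-a) (by
      simp only [Algebra.smul_def] at h0
      rw [map_neg]
      linear_combination h0)
    exact hne ⟨neg_eq_zero.mp this.2, this.1⟩
  -- Let `Δ` be the determinant formed by the fixed vectors `(x, y)` and `(a, b)`. Applying `T` to
  -- the squared vectors gives `det T · Δ² = Δ`. Hence `Δ` is the inverse of `det T`, a nonzero
  -- element of `F`, although its trace is zero.
  have hΔ' : (b • x - a • y) * algebraMap F _ (α * δ - β * γ) = 1 := by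
    apply mul_left_cancel₀ hΔ
    simp only [Algebra.smul_def, map_sub, map_mul]
    generalize algebraMap F (CubicExt F) a = a at *
    generalize algebraMap F (CubicExt F) b = b at *
    generalize algebraMap F (CubicExt F) α = α at *
    generalize algebraMap F (CubicExt F) β = β at *
    generalize algebraMap F (CubicExt F) γ = γ at *
    generalize algebraMap F (CubicExt F) δ = δ at *
    linear_combination (α * δ - β * γ) * (a ^ 2 * y ^ 2 - a * b * x * y) * h2 -
      b * e1 + (α * x ^ 2 + β * y ^ 2) * hb' + a * e2 - (γ * x ^ 2 + δ * y ^ 2) * ha'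
  have htrΔ : Algebra.trace F (CubicExt F) (b • x - a • y) = 0 := by
    rw [map_sub, map_smul, map_smul, hx, hy, smul_zero, smul_zero, sub_zero]
  rw [eq_inv_of_mul_eq_one_left hΔ', ← map_inv₀, trace_algebraMap_cubicExt] at htrΔ
  exact inv_ne_zero hD htrΔ

theorem congruent_of_planeI {α₀ β₀ γ₀ δ₀ : F} (hD₀ : α₀ * δ₀ - β₀ * γ₀ ≠ 0)
    (hfix₀ : ∀ x y : F, IsFixedVector α₀ β₀ γ₀ δ₀ x y → x = 0 ∧ y = 0) {α β γ δ : F}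
    (h : IsNucleusPointSpace (LinearMap.range (planeI α β γ δ))) :
    SymCongruent (LinearMap.range (planeI α β γ δ)) (LinearMap.range (planeI α₀ β₀ γ₀ δ₀)) ∨
    SymCongruent (LinearMap.range (planeI α β γ δ)) (LinearMap.range (planeI (1 : F) 0 0 1)) ∨
    ∃ e : F, (∀ x : F, x ^ 2 + x + e ≠ 0) ∧
      SymCongruent (LinearMap.range (planeI α β γ δ)) (LinearMap.range (planeI 1 e 0 1)) := by
  by_cases hfix : ∀ x y : F, IsFixedVector α β γ δ x y → x = 0 ∧ y = 0
  · obtain ⟨x, y, hxy⟩ := exists_isCubicFixedVector h.det_ne_zero hfix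
    obtain ⟨x₀, y₀, hxy₀⟩ := exists_isCubicFixedVector hD₀ hfix₀
    exact .inl (hxy.congruent hxy₀)
  · push Not at hfix
    obtain ⟨p, r, hpr, hne⟩ := hfix
    obtain ⟨e, he⟩ := congruent_of_isFixedVector h (fun h0 => hne h0.1 h0.2) hpr
    by_cases hroot : ∀ x : F, x ^ 2 + x + e ≠ 0
    · exact .inr (.inr ⟨e, hroot, he⟩)
    · push Not at hroot
      obtain ⟨x, hx⟩ := hroot
      exact .inr (.inl (he.trans (congruent_planeI_one hx)))

end CubicExtension

/-! ### Counting points -/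

/-- A cone is the origin together with `q - 1` nonzero multiples for each of its projective points.
-/
lemma ncard_eq_ncard_points_mul [Fintype F] {A : Set (Fin 6 → F)} (h0 : 0 ∈ A)
    (hA : ∀ (c : Fˣ) (v : Fin 6 → F), c • v ∈ A ↔ v ∈ A) :
    A.ncard = {P : PG5 F | P.rep ∈ A}.ncard * (Fintype.card F - 1) + 1 := by
  let f : PG5 F × Fˣ → (Fin 6 → F) := fun x => x.2 • x.1.rep
  have hf : Function.Injective f := by
    rintro ⟨P, c⟩ ⟨Q, d⟩ h
    have h' : c • P.rep = d • Q.rep := h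
    have hPQ : P = Q := by
      rw [← P.mk_rep, ← Q.mk_rep, Projectivization.mk_eq_mk_iff]
      exact ⟨c⁻¹ * d, by rw [mul_smul, ← h', inv_smul_smul]⟩
    subst hPQ
    rw [Prod.mk.injEq]
    exact ⟨rfl, Units.ext (smul_left_injective F P.rep_nonzero h')⟩
  have himg : f '' ({P : PG5 F | P.rep ∈ A} ×ˢ Set.univ) = A \ {0} := by
    ext v
    constructor
    · rintro ⟨⟨P, c⟩, ⟨hP, -⟩, rfl⟩
      exact ⟨(hA c _).mpr hP, (smul_ne_zero_iff_ne c).mpr P.rep_nonzero⟩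
    · rintro ⟨hv, hv0⟩
      obtain ⟨c, hc⟩ := Projectivization.exists_smul_eq_mk_rep F v hv0
      refine ⟨(Projectivization.mk F v hv0, c⁻¹), ⟨?_, Set.mem_univ _⟩, ?_⟩
      · change (Projectivization.mk F v hv0).rep ∈ A
        rwa [← hc, hA]
      · change c⁻¹ • (Projectivization.mk F v hv0).rep = v
        rw [← hc, inv_smul_smul]
  have h1 := Set.ncard_image_of_injective ({P : PG5 F | P.rep ∈ A} ×ˢ Set.univ) hf
  rw [himg, Set.ncard_prod, Set.ncard_univ, Nat.card_units, Nat.card_eq_fintype_card] at h1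
  rw [← h1, Set.ncard_sdiff_singleton_add_one h0]

lemma rep_mem_submodule_iff (W : Subsp5 F) (P : PG5 F) : P.rep ∈ submodule W ↔ P ∈ W := by
  rw [Projectivization.Subspace.mem_submodule_iff W P.rep_nonzero, P.mk_rep]

lemma ncard_points [Fintype F] {W : Subsp5 F} (hW : Module.finrank F (submodule W) = 3) :
    {P : PG5 F | P ∈ W}.ncard = Fintype.card F ^ 2 + Fintype.card F + 1 := by
  have h := ncard_eq_ncard_points_mul (A := (submodule W : Set (Fin 6 → F)))
    (Submodule.zero_mem _) (fun c v => Submodule.smul_mem_iff _ c.ne_zero)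
  simp only [SetLike.mem_coe, rep_mem_submodule_iff] at h
  rw [← Nat.card_coe_set_eq, SetLike.coe_sort_coe,
    Module.natCard_eq_pow_finrank (K := F), hW, Nat.card_eq_fintype_card] at h
  have hq : 1 < Fintype.card F := Fintype.one_lt_card
  obtain ⟨m, hm⟩ : ∃ m, Fintype.card F = m + 1 := ⟨Fintype.card F - 1, by omega⟩
  rw [hm] at h hq ⊢
  apply Nat.eq_of_mul_eq_mul_right (show 0 < m by omega)
  rw [Nat.add_sub_cancel] at h
  linarith [show (m + 1) ^ 3 = ((m + 1) ^ 2 + (m + 1) + 1) * m + 1 by ring]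

lemma symMat_smul (c : F) (v : Fin 6 → F) : symMat (c • v) = c • symMat v := by
  ext i j
  fin_cases i <;> fin_cases j <;> simp [symMat]

lemma det_symMat_congrLin (A : Matrix (Fin 3) (Fin 3) F) (v : Fin 6 → F) :
    (symMat (congrLin A v)).det = A.det ^ 2 * (symMat v).det := by
  rw [symMat_congrLin, Matrix.det_mul, Matrix.det_mul, Matrix.det_transpose]
  ring

lemma ncard_singular_points [Fintype F] (W : Subsp5 F) {φ : (Fin 3 → F) →ₗ[F] (Fin 6 → F)}
    (hφ : Function.Injective φ) (h : SymCongruent (LinearMap.range φ) (submodule W)) :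
    {x : Fin 3 → F | (symMat (φ x)).det = 0}.ncard =
      {P : PG5 F | P ∈ W ∧ (symMat P.rep).det = 0}.ncard * (Fintype.card F - 1) + 1 := by
  have h1 := ncard_eq_ncard_points_mul
    (A := {v : Fin 6 → F | v ∈ submodule W ∧ (symMat v).det = 0})
    ⟨Submodule.zero_mem _, by simp [symMat, Matrix.det_fin_three]⟩ (fun c v => by
      refine and_congr (Submodule.smul_mem_iff _ c.ne_zero) ?_
      rw [Units.smul_def, symMat_smul, Matrix.det_smul]
      simp)
  simp only [Set.mem_ofPred_eq, rep_mem_submodule_iff] at h1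
  rw [← h1]
  obtain ⟨A, hA, hAW⟩ := h
  rw [← Set.ncard_image_of_injective _ ((congrLin_injective hA).comp hφ)]
  congr 1
  ext v
  rw [← hAW]
  constructor
  · rintro ⟨x, hx, rfl⟩
    refine ⟨⟨φ x, ⟨x, rfl⟩, rfl⟩, ?_⟩
    rw [Function.comp_apply, det_symMat_congrLin, hx, mul_zero]
  · rintro ⟨⟨_, ⟨x, rfl⟩, rfl⟩, hx⟩
    rw [det_symMat_congrLin, mul_eq_zero, or_iff_right (pow_ne_zero 2 hA)] at hx
    exact ⟨x, hx, rfl⟩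

/-! ### Point-orbit distributions -/

lemma rank_eq_three_iff {M : Matrix (Fin 3) (Fin 3) F} : M.rank = 3 ↔ M.det ≠ 0 := by
  constructor
  · intro h h0
    obtain ⟨v, hv, hv0⟩ := Matrix.exists_mulVec_eq_zero_iff.mpr h0
    have h1 := LinearMap.finrank_range_add_finrank_ker M.mulVecLin
    rw [Matrix.rank] at h
    rw [h, Module.finrank_fintype_fun_eq_card, Fintype.card_fin] at h1
    have h2 : Module.finrank F (LinearMap.ker M.mulVecLin) = 0 := by omega
    rw [Submodule.finrank_eq_zero] at h2
    have : v ∈ LinearMap.ker M.mulVecLin := hv0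
    rw [h2, Submodule.mem_bot] at this
    exact hv this
  · intro h
    simpa using Matrix.rank_of_det_ne_zero h

lemma rep_mem_nucleusSubmodule_iff (P : PG5 F) : P.rep ∈ nucleusSubmodule F ↔
    P ∈ nucleusPlane F := by
  rw [← rep_mem_submodule_iff]
  simp [nucleusPlane]

lemma pointRank_eq_three_iff (P : PG5 F) : pointRank P = 3 ↔ (symMat P.rep).det ≠ 0 :=
  rank_eq_three_iff

section Distribution

variable [CharP F 2]

/-- The vanishing of the principal 2×2 minors makes each squared off-diagonal entry the product of
two diagonal entries. Square roots exist and are unique, so the square roots of the diagonal give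
`u`. -/
lemma exists_eq_veroneseVec [Finite F] {v : Fin 6 → F} (h : (symMat v).rank ≤ 1) :
    ∃ u, v = veroneseVec u := by
  rw [Matrix.rank_eq_finrank_span_cols] at h
  obtain ⟨⟨x, _⟩, hx⟩ := finrank_le_one_iff.mp h
  have hx' (j : Fin 3) : ∃ c : F, c • x = (symMat v).col j := by
    obtain ⟨c, hc⟩ := hx ⟨(symMat v).col j, Submodule.subset_span ⟨j, rfl⟩⟩
    exact ⟨c, congrArg Subtype.val hc⟩
  choose c hc using hx'
  have hM (i j : Fin 3) : symMat v i j = c j * x i :=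
    (congrFun (hc j) i).symm
  have hminor (i j : Fin 3) : symMat v i j ^ 2 = symMat v i i * symMat v j j := by
    have hs : symMat v i j = symMat v j i := congrFun (congrFun (symMat_transpose v) j) i
    rw [sq]
    nth_rw 2 [hs]
    rw [hM, hM, hM, hM]
    ring
  choose u hu using fun i : Fin 3 => exists_sq_eq (symMat v i i)
  refine ⟨u, ?_⟩
  have h01 : v 1 = u 0 * u 1 := sq_injective_char_two (by
    rw [mul_pow, hu, hu]
    exact hminor 0 1)
  have h02 : v 2 = u 0 * u 2 := sq_injective_char_two (by
    rw [mul_pow, hu, hu]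
    exact hminor 0 2)
  have h12 : v 4 = u 1 * u 2 := sq_injective_char_two (by
    rw [mul_pow, hu, hu]
    exact hminor 1 2)
  ext i
  fin_cases i
  · exact (hu 0).symm
  · exact h01
  · exact h02
  · exact (hu 1).symm
  · exact h12
  · exact (hu 2).symm

lemma det_symMat_of_mem_nucleusSubmodule {v : Fin 6 → F} (h : v ∈ nucleusSubmodule F) :
    (symMat v).det = 0 := by
  obtain ⟨h0, h3, h5⟩ := h
  have h2 : (2 : F) = 0 := CharTwo.two_eq_zero
  simp [symMat, Matrix.det_fin_three, h0, h3, h5]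
  linear_combination v 1 * v 2 * v 4 * h2

lemma one_lt_pointRank [Finite F] {W : Subsp5 F} (hW : W ∈ nucleusPointPlanes F) {P : PG5 F}
    (hP : P ∈ W) : 1 < pointRank P := by
  by_contra hlt
  obtain ⟨u, hu⟩ := exists_eq_veroneseVec (not_lt.mp hlt)
  have hu0 : u ≠ 0 := by
    rintro rfl
    apply P.rep_nonzero
    rw [hu]
    ext i
    fin_cases i <;> simp [veroneseVec]
  apply ((mem_nucleusPointPlanes_iff W).mp hW).veroneseVec_notMem u hu0
  rw [← hu, rep_mem_submodule_iff]
  exact hP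

lemma pointRank_eq_two_iff [Finite F] {W : Subsp5 F} (hW : W ∈ nucleusPointPlanes F) {P : PG5 F}
    (hP : P ∈ W) : pointRank P = 2 ↔ (symMat P.rep).det = 0 := by
  have h1 := one_lt_pointRank hW hP
  have h2 : pointRank P ≤ 3 := Matrix.rank_le_width _
  have h3 := pointRank_eq_three_iff P
  rw [← not_iff_not, ← Ne, ← Ne, ← h3]
  omega

/-- No point has rank 1, so rank 2 is the same as vanishing determinant. The single nucleus point is
one of these zeros, since alternating 3×3 matrices are singular. -/
theorem OD0_eq [Fintype F] {W : Subsp5 F} (hW : W ∈ nucleusPointPlanes F) :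
    OD0 W = ![0, 1, {P : PG5 F | P ∈ W ∧ (symMat P.rep).det = 0}.ncard - 1,
      Fintype.card F ^ 2 + Fintype.card F + 1 -
        {P : PG5 F | P ∈ W ∧ (symMat P.rep).det = 0}.ncard] := by
  obtain ⟨hfin, hdisj, N, hN⟩ := id hW
  have hmem (P : PG5 F) : P ∈ W ∧ P ∈ nucleusPlane F ↔ P = N := by
    rw [← Set.mem_singleton_iff, ← hN]
    rfl
  have hNdet : (symMat N.rep).det = 0 := det_symMat_of_mem_nucleusSubmodule
    ((rep_mem_nucleusSubmodule_iff N).mpr ((hmem N).mpr rfl).2)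
  have e0 : {P : PG5 F | P ∈ W ∧ pointRank P = 1} = ∅ := by
    rw [Set.eq_empty_iff_forall_notMem]
    rintro P ⟨hP, h1⟩
    exact absurd (one_lt_pointRank hW hP) (by omega)
  have e1 : {P : PG5 F | P ∈ W ∧ pointRank P = 2 ∧ P ∈ nucleusPlane F} = {N} := by
    ext P
    rw [Set.mem_ofPred_eq, Set.mem_singleton_iff, ← hmem]
    refine ⟨fun h => ⟨h.1, h.2.2⟩, fun h => ⟨h.1, ?_, h.2⟩⟩
    rw [pointRank_eq_two_iff hW h.1, (hmem P).mp h]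
    exact hNdet
  have e2 : {P : PG5 F | P ∈ W ∧ pointRank P = 2 ∧ P ∉ nucleusPlane F ∧ P ∉ veroneseSurface F} =
      {P : PG5 F | P ∈ W ∧ (symMat P.rep).det = 0} \ {N} := by
    ext P
    rw [Set.mem_sdiff, Set.mem_singleton_iff, ← hmem]
    constructor
    · rintro ⟨hP, h2, h3, -⟩
      exact ⟨⟨hP, (pointRank_eq_two_iff hW hP).mp h2⟩, fun h => h3 h.2⟩
    · rintro ⟨⟨hP, h2⟩, h3⟩
      exact ⟨hP, (pointRank_eq_two_iff hW hP).mpr h2, fun h => h3 ⟨hP, h⟩,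
        Set.disjoint_left.mp hdisj hP⟩
  have e3 : {P : PG5 F | P ∈ W ∧ pointRank P = 3} =
      {P : PG5 F | P ∈ W} \ {P : PG5 F | P ∈ W ∧ (symMat P.rep).det = 0} := by
    ext P
    simp only [Set.mem_sdiff, Set.mem_ofPred_eq, pointRank_eq_three_iff]
    tauto
  rw [OD0, e0, e1, e2, e3, Set.ncard_empty, Set.ncard_singleton, Set.ncard_sdiff_singleton_of_mem
    (show N ∈ {P : PG5 F | P ∈ W ∧ (symMat P.rep).det = 0} from ⟨((hmem N).mpr rfl).1, hNdet⟩),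
    Set.ncard_sdiff (fun P hP => hP.1), ncard_points hfin]

theorem OD0_eq_of_congruent [Fintype F] {W : Subsp5 F} {φ : (Fin 3 → F) →ₗ[F] (Fin 6 → F)}
    (hφ : IsNucleusPointSpace (LinearMap.range φ)) (hinj : Function.Injective φ)
    (h : SymCongruent (LinearMap.range φ) (submodule W)) {m : ℕ}
    (hm : {x : Fin 3 → F | (symMat (φ x)).det = 0}.ncard = (m + 1) * (Fintype.card F - 1) + 1) :
    OD0 W = ![0, 1, m, Fintype.card F ^ 2 + Fintype.card F - m] := by
  have hW : W ∈ nucleusPointPlanes F :=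
    (mem_nucleusPointPlanes_iff W).mpr (h.isNucleusPointSpace hφ)
  rw [ncard_singular_points W hinj h, Nat.add_right_cancel_iff] at hm
  have hq : 1 < Fintype.card F := Fintype.one_lt_card
  rw [OD0_eq hW, Nat.eq_of_mul_eq_mul_right (by omega) hm, Nat.add_sub_cancel,
    Nat.add_sub_add_right]

end Distribution

/-! ### Representatives and their distributions -/

section Counting

variable [Fintype F]

lemma ncard_setOf_fst_eq_zero : {x : Fin 3 → F | x 0 = 0}.ncard = Fintype.card F ^ 2 := by
  have h : {x : Fin 3 → F | x 0 = 0} =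
      Set.range fun p : F × F => (![0, p.1, p.2] : Fin 3 → F) := by
    ext x
    constructor
    · intro hx
      have hx' : x 0 = 0 := hx
      refine ⟨(x 1, x 2), ?_⟩
      ext i
      fin_cases i <;> simp [hx']
    · rintro ⟨p, rfl⟩
      simp
  rw [h, ← Set.image_univ, Set.ncard_image_of_injective, Set.ncard_univ, Nat.card_prod,
    Nat.card_eq_fintype_card, sq]
  intro p p' hp
  exact Prod.ext (congrFun hp 1) (congrFun hp 2)

lemma ncard_setOf_snd_eq_zero : {x : Fin 3 → F | x 1 = 0}.ncard = Fintype.card F ^ 2 := by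
  have h : {x : Fin 3 → F | x 1 = 0} =
      Set.range fun p : F × F => (![p.1, 0, p.2] : Fin 3 → F) := by
    ext x
    constructor
    · intro hx
      have hx' : x 1 = 0 := hx
      refine ⟨(x 0, x 2), ?_⟩
      ext i
      fin_cases i <;> simp [hx']
    · rintro ⟨p, rfl⟩
      simp
  rw [h, ← Set.image_univ, Set.ncard_image_of_injective, Set.ncard_univ, Nat.card_prod,
    Nat.card_eq_fintype_card, sq]
  intro p p' hp
  exact Prod.ext (congrFun hp 0) (congrFun hp 2)

lemma ncard_setOf_fst_snd_eq_zero :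
    {x : Fin 3 → F | x 0 = 0 ∧ x 1 = 0}.ncard = Fintype.card F := by
  have h : {x : Fin 3 → F | x 0 = 0 ∧ x 1 = 0} =
      Set.range fun c : F => (![0, 0, c] : Fin 3 → F) := by
    ext x
    constructor
    · rintro ⟨h0, h1⟩
      refine ⟨x 2, ?_⟩
      ext i
      fin_cases i <;> simp [h0, h1]
    · rintro ⟨p, rfl⟩
      simp
  rw [h, ← Set.image_univ, Set.ncard_image_of_injective, Set.ncard_univ, Nat.card_eq_fintype_card]
  intro p p' hp
  exact congrFun hp 2

lemma ncard_setOf_snd_eq (g : F → F → F) : {x : Fin 3 → F | x 0 ≠ 0 ∧ x 1 = g (x 0) (x 2)}.ncard =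
    (Fintype.card F - 1) * Fintype.card F := by
  have h : {x : Fin 3 → F | x 0 ≠ 0 ∧ x 1 = g (x 0) (x 2)} =
      Set.range fun p : Fˣ × F => (![p.1, g p.1 p.2, p.2] : Fin 3 → F) := by
    ext x
    constructor
    · rintro ⟨h0, h1⟩
      refine ⟨(Units.mk0 _ h0, x 2), ?_⟩
      ext i
      fin_cases i <;> simp [h1]
    · rintro ⟨p, rfl⟩
      simp
  rw [h, ← Set.image_univ, Set.ncard_image_of_injective, Set.ncard_univ, Nat.card_prod,
    Nat.card_units, Nat.card_eq_fintype_card]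
  intro p p' hp
  exact Prod.ext (Units.ext (congrFun hp 0)) (congrFun hp 2)

lemma ncard_setOf_trd_eq (g : F → F → F) : {x : Fin 3 → F | x 0 ≠ 0 ∧ x 2 = g (x 0) (x 1)}.ncard =
    (Fintype.card F - 1) * Fintype.card F := by
  have h : {x : Fin 3 → F | x 0 ≠ 0 ∧ x 2 = g (x 0) (x 1)} =
      Set.range fun p : Fˣ × F => (![p.1, p.2, g p.1 p.2] : Fin 3 → F) := by
    ext x
    constructor
    · rintro ⟨h0, h1⟩
      refine ⟨(Units.mk0 _ h0, x 1), ?_⟩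
      ext i
      fin_cases i <;> simp [h1]
    · rintro ⟨p, rfl⟩
      simp
  rw [h, ← Set.image_univ, Set.ncard_image_of_injective, Set.ncard_univ, Nat.card_prod,
    Nat.card_units, Nat.card_eq_fintype_card]
  intro p p' hp
  exact Prod.ext (Units.ext (congrFun hp 0)) (congrFun hp 1)

end Counting

lemma sq_add_mul_add_eq_zero {e x y : F} (h : ∀ x : F, x ^ 2 + x + e ≠ 0)
    (hxy : x ^ 2 + x * y + e * y ^ 2 = 0) : x = 0 ∧ y = 0 := by
  have hy : y = 0 := by
    by_contra hy
    apply h (x / y)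
    field_simp
    linear_combination hxy
  subst hy
  exact ⟨by simpa using hxy, rfl⟩

lemma isNucleusPointSpace_planeII_one_zero :
    IsNucleusPointSpace (LinearMap.range (planeII (1 : F) 0 0 1)) :=
  isNucleusPointSpace_planeII fun x y h1 h2 => by
    obtain rfl : y = 0 := by simpa using h2
    exact ⟨by simpa using h1.symm, rfl⟩

lemma isNucleusPointSpace_planeII_zero_one :
    IsNucleusPointSpace (LinearMap.range (planeII (0 : F) 1 1 0)) :=
  isNucleusPointSpace_planeII fun x y h1 h2 => by
    obtain rfl : x = 0 := by simpa using h2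
    exact ⟨rfl, by simpa using h1.symm⟩

section Representatives

variable [CharP F 2]

lemma det_symMat_planeI (α β γ δ : F) (x : Fin 3 → F) : (symMat (planeI α β γ δ x)).det =
    x 0 * (γ * x 0 + δ * x 1) ^ 2 + x 1 * (α * x 0 + β * x 1) ^ 2 := by
  have h2 : (2 : F) = 0 := CharTwo.two_eq_zero
  simp [symMat, Matrix.det_fin_three, planeI_apply]
  linear_combination (x 2 * (γ * x 0 + δ * x 1) * (α * x 0 + β * x 1)
    - x 0 * (γ * x 0 + δ * x 1) ^ 2 - x 1 * (α * x 0 + β * x 1) ^ 2) * h2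

lemma det_symMat_planeII (α β γ δ : F) (x : Fin 3 → F) : (symMat (planeII α β γ δ x)).det =
    x 0 * x 2 ^ 2 + x 1 * (γ * x 0 + δ * x 1) ^ 2 := by
  have h2 : (2 : F) = 0 := CharTwo.two_eq_zero
  simp [symMat, Matrix.det_fin_three, planeII_apply]
  linear_combination (x 2 * (γ * x 0 + δ * x 1) * (α * x 0 + β * x 1)
    - x 0 * x 2 ^ 2 - x 1 * (γ * x 0 + δ * x 1) ^ 2) * h2

/-- At `x = r²` the expression is `(r² + r + e)²`. It is needed because the cubic of `planeI 1 e 0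
1` involves `e²`. -/
lemma sq_add_self_add_sq_ne_zero [Finite F] {e : F} (h : ∀ x : F, x ^ 2 + x + e ≠ 0) (x : F) :
    x ^ 2 + x + e ^ 2 ≠ 0 := by
  obtain ⟨r, rfl⟩ := exists_sq_eq x
  rw [← add_sq_char_two, ← add_sq_char_two]
  exact pow_ne_zero 2 (h r)

lemma isNucleusPointSpace_planeII_of_forall_ne_zero {e : F} (h : ∀ x : F, x ^ 2 + x + e ≠ 0) :
    IsNucleusPointSpace (LinearMap.range (planeII e 1 0 0)) :=
  isNucleusPointSpace_planeII fun x y h1 _ => by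
    have h2 : (2 : F) = 0 := CharTwo.two_eq_zero
    exact (sq_add_mul_add_eq_zero h (x := y) (y := x) (by
      linear_combination -h1 + x * y * h2)).symm

variable [Fintype F]

/-- Writing `x 0 = a²` and `x 1 = b²`, the determinant is the square of the form whose zeros are the
vectors `(a, b)` parallel to their image `T (a, b)⁽²⁾`; without fixed vectors only `(0, 0)` remains.
-/
lemma ncard_planeI_of_forall {α β γ δ : F} (hD : α * δ - β * γ ≠ 0)
    (hfix : ∀ x y : F, IsFixedVector α β γ δ x y → x = 0 ∧ y = 0) :
    {x : Fin 3 → F | (symMat (planeI α β γ δ x)).det = 0}.ncard = Fintype.card F := by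
  rw [← ncard_setOf_fst_snd_eq_zero (F := F)]
  congr 1
  ext x
  rw [Set.mem_ofPred_eq, Set.mem_ofPred_eq, det_symMat_planeI]
  refine ⟨fun h => ?_, fun ⟨h0, h1⟩ => by simp [h0, h1]⟩
  obtain ⟨a, ha⟩ := exists_sq_eq (x 0)
  obtain ⟨b, hb⟩ := exists_sq_eq (x 1)
  have h2 : (2 : F) = 0 := CharTwo.two_eq_zero
  rw [← ha, ← hb, pow_eq_zero_iff two_ne_zero, pow_eq_zero_iff two_ne_zero]
  rw [← ha, ← hb, ← mul_pow, ← mul_pow, ← add_sq_char_two, pow_eq_zero_iff two_ne_zero] at h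
  by_contra hne
  obtain ⟨c, hc, hcf⟩ := exists_isFixedVector hD hne (by
    linear_combination h - b * (α * a ^ 2 + β * b ^ 2) * h2)
  exact hne (by simpa [hc] using hfix _ _ hcf)

lemma ncard_planeI_one : {x : Fin 3 → F | (symMat (planeI (1 : F) 0 0 1 x)).det = 0}.ncard =
    Fintype.card F ^ 2 + (Fintype.card F - 1) * Fintype.card F +
      (Fintype.card F - 1) * Fintype.card F := by
  rw [← ncard_setOf_fst_eq_zero (F := F), ← ncard_setOf_snd_eq (fun _ _ : F => 0)]
  -- The previous rewrite turned both equal summands into the count for `x 1 = 0`; the second is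
  -- restored in order to count `x 1 = x 0`.
  nth_rw 2 [ncard_setOf_snd_eq (fun _ _ : F => 0)]
  rw [← ncard_setOf_snd_eq (fun a _ : F => a), ← Set.ncard_union_eq, ← Set.ncard_union_eq]
  · congr 1
    ext x
    simp only [Set.mem_ofPred_eq, Set.mem_union, det_symMat_planeI]
    have : x 0 * (0 * x 0 + 1 * x 1) ^ 2 + x 1 * (1 * x 0 + 0 * x 1) ^ 2 =
      x 0 * (x 1 * (x 1 + x 0)) := by ring
    rw [this, mul_eq_zero, mul_eq_zero, CharTwo.add_eq_zero]
    tauto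
  · rw [Set.disjoint_left]
    rintro x (h | ⟨h, h'⟩) ⟨h0, h1⟩
    · exact h0 h
    · exact h0 (h1.symm.trans h')
  · rw [Set.disjoint_left]
    rintro x h ⟨h0, h1⟩
    exact h0 h

lemma ncard_planeI_of_forall_ne_zero {e : F} (h : ∀ x : F, x ^ 2 + x + e ≠ 0) :
    {x : Fin 3 → F | (symMat (planeI 1 e 0 1 x)).det = 0}.ncard = Fintype.card F ^ 2 := by
  rw [← ncard_setOf_snd_eq_zero (F := F)]
  congr 1
  ext x
  rw [Set.mem_ofPred_eq, Set.mem_ofPred_eq, det_symMat_planeI]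
  have h2 : (2 : F) = 0 := CharTwo.two_eq_zero
  have : x 0 * (0 * x 0 + 1 * x 1) ^ 2 + x 1 * (1 * x 0 + e * x 1) ^ 2 =
      x 1 * (x 0 ^ 2 + x 0 * x 1 + e ^ 2 * x 1 ^ 2) := by
    linear_combination x 1 * x 0 * e * x 1 * h2
  rw [this, mul_eq_zero]
  exact ⟨fun h' => h'.elim id fun h' =>
    (sq_add_mul_add_eq_zero (sq_add_self_add_sq_ne_zero h) h').2, .inl⟩

lemma ncard_planeII_one_zero :
    {x : Fin 3 → F | (symMat (planeII (1 : F) 0 0 1 x)).det = 0}.ncard =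
      Fintype.card F + (Fintype.card F - 1) * Fintype.card F := by
  choose s hs using exists_sq_eq (F := F)
  -- Away from `x 0 = 0` the cuspidal cubic is a graph: `x 2` is the unique square root of `x 1 ^ 3
  -- / x 0`.
  rw [← ncard_setOf_trd_eq (fun a b : F => s (b ^ 3 / a))]
  nth_rw 1 [← ncard_setOf_fst_snd_eq_zero (F := F)]
  rw [← Set.ncard_union_eq]
  · congr 1
    ext x
    simp only [Set.mem_ofPred_eq, Set.mem_union, det_symMat_planeII]
    by_cases h0 : x 0 = 0
    · simp [h0]
    · simp only [h0, false_and, ne_eq, not_false_eq_true, true_and, false_or]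
      have : x 2 = s (x 1 ^ 3 / x 0) ↔ x 2 ^ 2 = x 1 ^ 3 / x 0 := by
        constructor
        · intro h
          rw [h, hs]
        · intro h
          exact sq_injective_char_two (by rw [h, hs])
      rw [this, eq_div_iff h0, CharTwo.add_eq_zero]
      ring_nf
  · rw [Set.disjoint_left]
    rintro x h ⟨h0, h1⟩
    exact h0 h.1

lemma ncard_planeII_of_snd_eq_zero (α β : F) :
    {x : Fin 3 → F | (symMat (planeII α β 0 0 x)).det = 0}.ncard =
      Fintype.card F ^ 2 + (Fintype.card F - 1) * Fintype.card F := by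
  rw [← ncard_setOf_fst_eq_zero (F := F), ← ncard_setOf_trd_eq (fun _ _ : F => 0),
    ← Set.ncard_union_eq]
  · congr 1
    ext x
    simp only [Set.mem_ofPred_eq, Set.mem_union, det_symMat_planeII]
    by_cases h0 : x 0 = 0 <;> simp [h0]
  · rw [Set.disjoint_left]
    rintro x h ⟨h0, h1⟩
    exact h0 h

lemma ncard_planeII_zero_one :
    {x : Fin 3 → F | (symMat (planeII (0 : F) 1 1 0 x)).det = 0}.ncard =
      Fintype.card F ^ 2 + (Fintype.card F - 1) * Fintype.card F := by
  rw [← ncard_setOf_fst_eq_zero (F := F), ← ncard_setOf_snd_eq (fun a b : F => b ^ 2 / a),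
    ← Set.ncard_union_eq]
  · congr 1
    ext x
    simp only [Set.mem_ofPred_eq, Set.mem_union, det_symMat_planeII]
    by_cases h0 : x 0 = 0
    · simp [h0]
    · have : x 0 * x 2 ^ 2 + x 1 * (1 * x 0 + 0 * x 1) ^ 2 = x 0 * (x 1 * x 0 + x 2 ^ 2) := by ring
      rw [this, mul_eq_zero, CharTwo.add_eq_zero, ← eq_div_iff h0]
      simp [h0]
  · rw [Set.disjoint_left]
    rintro x h ⟨h0, h1⟩
    exact h0 h

end Representatives

/-! ### Linear forms -/

section LinearForms

open MvPolynomial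

variable {R : Type*} [Field R]

/-- The linear forms `∑ᵢ P i j Xᵢ` whose coefficients are the columns of a matrix. -/
def linForm (P : Matrix (Fin 3) (Fin 3) R) (j : Fin 3) : MvPolynomial (Fin 3) R :=
  ∑ i, C (P i j) * X i

lemma isHomogeneous_linForm (P : Matrix (Fin 3) (Fin 3) R) (j : Fin 3) :
    (linForm P j).IsHomogeneous 1 :=
  .sum _ _ _ fun _ _ => isHomogeneous_C_mul_X _ _

lemma map_linForm {R' : Type*} [Field R'] (f : R →+* R') (P : Matrix (Fin 3) (Fin 3) R)
    (j : Fin 3) : MvPolynomial.map f (linForm P j) = linForm (P.map f) j := by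
  simp [linForm]

lemma det_map_ne_zero {R' : Type*} [Field R'] (f : R →+* R') {P : Matrix (Fin 3) (Fin 3) R}
    (hP : P.det ≠ 0) : (P.map f).det ≠ 0 := by
  rw [← RingHom.mapMatrix_apply, ← RingHom.map_det]
  simpa using hP

lemma eval_linForm (P : Matrix (Fin 3) (Fin 3) R) (v : Fin 3 → R) (j : Fin 3) :
    eval v (linForm P j) = (v ᵥ* P) j := by
  simp [linForm, Matrix.vecMul, dotProduct, mul_comm]

lemma pderiv_linForm (P : Matrix (Fin 3) (Fin 3) R) (i j : Fin 3) :
    pderiv i (linForm P j) = C (P i j) := by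
  simp [linForm, pderiv_X, Pi.single_apply]

lemma exists_eval_linForm {P : Matrix (Fin 3) (Fin 3) R} (hP : P.det ≠ 0) (w : Fin 3 → R) :
    ∃ v, ∀ j, eval v (linForm P j) = w j := by
  refine ⟨w ᵥ* P⁻¹, fun j => ?_⟩
  rw [eval_linForm, Matrix.vecMul_vecMul, Matrix.nonsing_inv_mul _ (Ne.isUnit hP),
    Matrix.vecMul_one]

lemma eq_zero_of_eval_linForm {P : Matrix (Fin 3) (Fin 3) R} (hP : P.det ≠ 0) {v : Fin 3 → R}
    (h : ∀ j, eval v (linForm P j) = 0) : v = 0 := by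
  by_contra hv
  exact hP (Matrix.exists_vecMul_eq_zero_iff.mp ⟨v, hv, funext fun j => by
    rw [← eval_linForm, h]; rfl⟩)

lemma aeval_linForm (P Q : Matrix (Fin 3) (Fin 3) R) (j : Fin 3) :
    aeval (linForm P) (linForm Q j) = linForm (P * Q) j := by
  simp only [linForm, map_sum, map_mul, aeval_X, Matrix.mul_apply, Finset.sum_mul, Finset.mul_sum,
    algHom_C, algebraMap_eq]
  rw [Finset.sum_comm]
  exact Finset.sum_congr rfl fun i _ => Finset.sum_congr rfl fun k _ => by ring

lemma linForm_one (j : Fin 3) : linForm (1 : Matrix (Fin 3) (Fin 3) R) j = X j := by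
  simp [linForm, Matrix.one_apply]

/-- An invertible linear substitution of the variables. -/
def substEquiv {P : Matrix (Fin 3) (Fin 3) R} (hP : P.det ≠ 0) :
    MvPolynomial (Fin 3) R ≃ₐ[R] MvPolynomial (Fin 3) R :=
  AlgEquiv.ofAlgHom (aeval (linForm P)) (aeval (linForm P⁻¹))
    (by
      ext1 j
      rw [AlgHom.comp_apply, aeval_X, aeval_linForm, Matrix.mul_nonsing_inv _ (Ne.isUnit hP),
        linForm_one, AlgHom.id_apply])
    (by
      ext1 j
      rw [AlgHom.comp_apply, aeval_X, aeval_linForm, Matrix.nonsing_inv_mul _ (Ne.isUnit hP),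
        linForm_one, AlgHom.id_apply])

lemma substEquiv_X {P : Matrix (Fin 3) (Fin 3) R} (hP : P.det ≠ 0) (j : Fin 3) :
    substEquiv hP (X j) = linForm P j := by
  simp [substEquiv]

/-- After a linear substitution the form is of degree 1 in `X 0` with coprime coefficients `X 2 ^ 2`
and `X 1 ^ 3`. -/
lemma irreducible_cuspidalCubic {P : Matrix (Fin 3) (Fin 3) R} (hP : P.det ≠ 0) {k : R}
    (hk : k ≠ 0) :
    Irreducible (C k * (linForm P 0 * linForm P 2 ^ 2 + linForm P 1 ^ 3)) := by
  have h1 : Irreducible ((X 2 ^ 2 : MvPolynomial (Fin 3) R) * X 0 + X 1 ^ 3) := by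
    refine irreducible_mul_X_add _ _ 0 (pow_ne_zero _ (X_ne_zero _)) ?_ ?_ ?_
    · exact fun h => by simpa using vars_pow _ _ h
    · exact fun h => by simpa using vars_pow _ _ h
    · refine IsRelPrime.pow ((X_prime.irreducible.isRelPrime_iff_not_dvd).mpr ?_)
      rw [X_dvd_X]
      decide
  have h2 := (MulEquiv.irreducible_iff (substEquiv hP)).mpr h1
  rw [irreducible_isUnit_mul ((Ne.isUnit hk).map C)]
  convert h2 using 1
  simp [substEquiv_X, mul_comm]

lemma exists_eq_linForm {m : MvPolynomial (Fin 3) R} (h : m.IsHomogeneous 1) :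
    ∃ g : Fin 3 → R, ∀ v, eval v m = ∑ i, g i * v i := by
  rw [← mem_homogeneousSubmodule, homogeneousSubmodule_one_eq_span_X,
    Submodule.mem_span_range_iff_exists_fun] at h
  obtain ⟨g, rfl⟩ := h
  exact ⟨g, fun v => by simp⟩

lemma constantCoeff_eq_zero {m : MvPolynomial (Fin 3) R} (h : m.IsHomogeneous 1) :
    constantCoeff m = 0 := by
  obtain ⟨g, hg⟩ := exists_eq_linForm h
  simpa [constantCoeff_eq] using hg 0

lemma linearIndependent_linForm {P : Matrix (Fin 3) (Fin 3) R} (hP : P.det ≠ 0) :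
    LinearIndependent R (linForm P) := by
  rw [Fintype.linearIndependent_iff]
  intro g hg j
  obtain ⟨v, hv⟩ := exists_eval_linForm hP (Pi.single j 1)
  have := congrArg (eval v) hg
  simpa [hv, smul_eval, Pi.single_apply] using this

/-- In characteristic 2 the square contributes nothing to the gradient of the conic. As `P` is
invertible, a zero gradient kills the forms 0 and 1, and the equation of the conic then kills form
2. -/
lemma eq_zero_of_conic_singular {P : Matrix (Fin 3) (Fin 3) R} (hP : P.det ≠ 0) {v : Fin 3 → R}
    (hd : ∀ i, P i 0 * eval v (linForm P 1) + P i 1 * eval v (linForm P 0) = 0)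
    (hQ : eval v (linForm P 2) ^ 2 + eval v (linForm P 0) * eval v (linForm P 1) = 0) :
    v = 0 := by
  have h0 : P *ᵥ ![eval v (linForm P 1), eval v (linForm P 0), 0] = 0 := by
    ext i
    simpa [Matrix.mulVec, dotProduct, Fin.sum_univ_three] using hd i
  have h3 : ![eval v (linForm P 1), eval v (linForm P 0), 0] = 0 := by
    by_contra hne
    exact hP (Matrix.exists_mulVec_eq_zero_iff.mp ⟨_, hne, h0⟩)
  have e1 : eval v (linForm P 1) = 0 := congrFun h3 0
  have e0 : eval v (linForm P 0) = 0 := congrFun h3 1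
  rw [e0, e1, mul_zero, add_zero, pow_eq_zero_iff two_ne_zero] at hQ
  refine eq_zero_of_eval_linForm hP fun j => ?_
  fin_cases j
  exacts [e0, e1, hQ]

end LinearForms

/-! ### The types of cubics -/

section Types

open MvPolynomial

lemma IsAbsolutelyIrreducible.not_isLineAndImaginaryPair {f : MvPolynomial (Fin 3) F}
    (h : IsAbsolutelyIrreducible f) : ¬IsLineAndImaginaryPair f := by
  rintro ⟨l, Q, hl, -, ⟨L, _, _, σ, m, c, -, hm, -, -, hQ⟩, rfl⟩
  have hnot {g : MvPolynomial (Fin 3) F} (hg : constantCoeff g = 0) :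
      ¬IsUnit (g.map (algebraMap F (AlgebraicClosure F))) := by
    intro hu
    have := hu.map (constantCoeff (σ := Fin 3) (R := AlgebraicClosure F))
    rw [constantCoeff_map, hg, map_zero] at this
    exact not_isUnit_zero this
  have hQ0 : constantCoeff Q = 0 := by
    apply (algebraMap F L).injective
    rw [← constantCoeff_map, hQ]
    simp [constantCoeff_eq_zero hm]
  rw [IsAbsolutelyIrreducible, map_mul] at h
  exact (h.isUnit_or_isUnit rfl).elim (hnot (constantCoeff_eq_zero hl)) (hnot hQ0)

lemma isAbsolutelyIrreducible_of_eq {P : Matrix (Fin 3) (Fin 3) F} (hP : P.det ≠ 0) {k : F}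
    (hk : k ≠ 0) : IsAbsolutelyIrreducible
      (C k * (linForm P 0 * linForm P 2 ^ 2 + linForm P 1 ^ 3)) := by
  have hP' := det_map_ne_zero (algebraMap F (AlgebraicClosure F)) hP
  rw [IsAbsolutelyIrreducible]
  simp only [map_mul, map_add, map_pow, map_linForm, map_C]
  exact irreducible_cuspidalCubic hP' (by simpa using hk)

lemma isLineAndDoubleLine_of_eq {P : Matrix (Fin 3) (Fin 3) F} (hP : P.det ≠ 0) {k : F}
    (hk : k ≠ 0) : IsLineAndDoubleLine (C k * (linForm P 0 * linForm P 2 ^ 2)) := by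
  refine ⟨C k * linForm P 0, linForm P 2, ?_, isHomogeneous_linForm _ _, ?_, by ring⟩
  · simpa using (isHomogeneous_C (Fin 3) k).mul (isHomogeneous_linForm P 0)
  · rw [LinearIndependent.pair_iff]
    intro s t h
    have := Fintype.linearIndependent_iff.mp (linearIndependent_linForm hP) ![s * k, 0, t] (by
      simpa [Fin.sum_univ_three, smul_eq_C_mul, mul_assoc] using h)
    exact ⟨by simpa [hk] using this 0, by simpa using this 2⟩

variable [CharP F 2]

/-- The quadratic extension generated by a root of `X² + X + e`. -/
lemma exists_quadratic_extension {e : F} (h : ∀ x : F, x ^ 2 + x + e ≠ 0) :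
    ∃ (L : Type u) (_ : Field L) (_ : Algebra F L) (σ : L ≃ₐ[F] L) (t : L),
      Module.finrank F L = 2 ∧ σ t = t + 1 ∧ t ^ 2 + t + algebraMap F L e = 0 := by
  let p : Polynomial F := .C 1 * .X ^ 2 + .C 1 * .X + .C e
  have hdeg : p.natDegree = 2 := Polynomial.natDegree_quadratic one_ne_zero
  have hirr : Irreducible p := by
    refine Polynomial.irreducible_of_degree_le_three_of_not_isRoot (by simp [hdeg]) fun x hx => ?_
    exact h x (by simpa [p, Polynomial.IsRoot] using hx)
  have : Fact (Irreducible p) := ⟨hirr⟩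
  have hfin : Module.finrank F (AdjoinRoot p) = 2 := by
    rw [(AdjoinRoot.powerBasis hirr.ne_zero).finrank, AdjoinRoot.powerBasis_dim, hdeg]
  have : Module.Finite F (AdjoinRoot p) := Module.finite_of_finrank_pos (by omega)
  have hroot : AdjoinRoot.root p ^ 2 + AdjoinRoot.root p + algebraMap F (AdjoinRoot p) e = 0 := by
    have := AdjoinRoot.eval₂_root p
    simpa [p, Polynomial.eval₂_add, AdjoinRoot.algebraMap_eq] using this
  have h2 : (2 : AdjoinRoot p) = 0 := by
    rw [← map_ofNat (algebraMap F (AdjoinRoot p)) 2, CharTwo.two_eq_zero, map_zero]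
  -- The other root of `X² + X + e` is `t + 1`, so this is the conjugation.
  let φ : AdjoinRoot p →ₐ[F] AdjoinRoot p :=
    AdjoinRoot.liftAlgHom p (Algebra.ofId F _) (AdjoinRoot.root p + 1) (by
      simp only [p, Polynomial.eval₂_add, Polynomial.eval₂_mul, Polynomial.eval₂_pow,
        Polynomial.eval₂_X, Polynomial.eval₂_C]
      simp only [RingHom.coe_coe, map_one, Algebra.ofId_apply]
      linear_combination hroot + (AdjoinRoot.root p + 1) * h2)
  refine ⟨AdjoinRoot p, inferInstance, inferInstance,
    AlgEquiv.ofBijective φ (Algebra.IsAlgebraic.algHom_bijective φ), AdjoinRoot.root p, hfin, ?_,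
    hroot⟩
  simp [φ]

lemma isLineAndImaginaryPair_of_eq {P : Matrix (Fin 3) (Fin 3) F} (hP : P.det ≠ 0) {k e : F}
    (hk : k ≠ 0) (he : ∀ x : F, x ^ 2 + x + e ≠ 0) : IsLineAndImaginaryPair
      (C k * (linForm P 1 *
        (linForm P 0 ^ 2 + linForm P 0 * linForm P 1 + C e * linForm P 1 ^ 2))) := by
  have hli := linearIndependent_linForm hP
  refine ⟨C k * linForm P 1, linForm P 0 ^ 2 + linForm P 0 * linForm P 1 + C e * linForm P 1 ^ 2,
    ?_, mul_ne_zero (C_ne_zero.mpr hk) (hli.ne_zero 1), ?_, by ring⟩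
  · simpa using (isHomogeneous_C (Fin 3) k).mul (isHomogeneous_linForm P 1)
  obtain ⟨L, _, _, σ, t, hfin, hσ, ht⟩ := exists_quadratic_extension he
  have hP' := det_map_ne_zero (algebraMap F L) hP
  have hPσ : (P.map (algebraMap F L)).map (σ : L →+* L) = P.map (algebraMap F L) := by
    ext i j
    simp
  have h2 : (2 : L) = 0 := by
    rw [← map_ofNat (algebraMap F L) 2, CharTwo.two_eq_zero, map_zero]
  have hm : (linForm (P.map (algebraMap F L)) 0 + C t * linForm (P.map (algebraMap F L)) 1).map
      (σ : L →+* L) = linForm (P.map (algebraMap F L)) 0 +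
        C (t + 1) * linForm (P.map (algebraMap F L)) 1 := by
    simp only [map_add, map_mul, map_linForm, map_C, hPσ]
    simp [hσ]
  refine ⟨L, _, _, σ,
    linForm (P.map (algebraMap F L)) 0 + C t * linForm (P.map (algebraMap F L)) 1, 1, hfin,
    ?_, one_ne_zero, ?_, ?_⟩
  · refine (isHomogeneous_linForm _ 0).add ?_
    simpa using (isHomogeneous_C (Fin 3) t).mul (isHomogeneous_linForm _ 1)
  · rw [hm, LinearIndependent.pair_iff]
    intro a b hab
    have := Fintype.linearIndependent_iff.mp (linearIndependent_linForm hP')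
      ![a + b, a * t + b * (t + 1), 0] (by
        rw [← hab]
        simp [Fin.sum_univ_three, smul_eq_C_mul]
        ring)
    have e0 : a + b = 0 := by simpa using this 0
    have e1 : a * t + b * (t + 1) = 0 := by simpa using this 1
    have hb : b = 0 := by linear_combination e1 - t * e0
    exact ⟨by simpa [hb] using e0, hb⟩
  · rw [hm]
    simp only [map_add, map_mul, map_pow, map_linForm, map_C, map_one]
    generalize linForm (P.map (algebraMap F L)) 0 = x
    generalize linForm (P.map (algebraMap F L)) 1 = y
    have hC := congrArg (C (σ := Fin 3)) ht
    have hC2 := congrArg (C (σ := Fin 3)) h2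
    simp only [map_add, map_pow, map_zero, map_ofNat] at hC hC2
    linear_combination -y ^ 2 * hC - (x * y * C t) * hC2 + y ^ 2 * C (algebraMap F L e) * hC2

lemma isConicAndTangent_of_eq {P : Matrix (Fin 3) (Fin 3) F} (hP : P.det ≠ 0) {k : F}
    (hk : k ≠ 0) : IsConicAndTangent
      (C k * (linForm P 0 * (linForm P 2 ^ 2 + linForm P 0 * linForm P 1))) := by
  have h2 : (2 : F) = 0 := CharTwo.two_eq_zero
  have hpd (i : Fin 3) : pderiv i (linForm P 2 ^ 2 + linForm P 0 * linForm P 1) =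
      C (P i 0) * linForm P 1 + C (P i 1) * linForm P 0 := by
    have hC2 : (2 : MvPolynomial (Fin 3) F) = 0 := by
      rw [← map_ofNat (C (σ := Fin 3) (R := F)) 2, h2, map_zero]
    simp only [map_add, Derivation.leibniz, Derivation.leibniz_pow, pderiv_linForm, smul_eq_mul,
      nsmul_eq_mul]
    push_cast
    linear_combination (linForm P 2 * C (P i 2)) * hC2
  refine ⟨C k * linForm P 0, linForm P 2 ^ 2 + linForm P 0 * linForm P 1, ⟨?_, ?_⟩, ?_, by ring⟩
  · exact ((isHomogeneous_linForm P 2).pow 2).add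
      ((isHomogeneous_linForm P 0).mul (isHomogeneous_linForm P 1))
  · intro v hv hQ
    by_contra! hd
    have hae (j : Fin 3) : aeval v (linForm P j) =
        eval v (linForm (P.map (algebraMap F (AlgebraicClosure F))) j) := by
      rw [← map_linForm, eval_map, aeval_def]
    simp only [hpd, map_add, map_mul, map_pow, hae, aeval_C] at hd hQ
    exact hv (eq_zero_of_conic_singular (det_map_ne_zero _ hP) hd hQ)
  -- At the point where the forms take the values 0, 1, 0 the gradient of the conic is column 0 of
  -- `P`, so the tangent there is `linForm P 0`.
  · obtain ⟨p, hp⟩ := exists_eval_linForm hP ![0, 1, 0]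
    have p0 : eval p (linForm P 0) = 0 := hp 0
    have p1 : eval p (linForm P 1) = 1 := hp 1
    have p2 : eval p (linForm P 2) = 0 := hp 2
    refine ⟨p, k, ?_, hk, ?_, ?_⟩
    · rintro rfl
      rw [eval_linForm] at p1
      simp at p1
    · simp [p0, p2]
    · simp only [hpd, map_add, map_mul, eval_C, p0, p1, mul_one, mul_zero, add_zero]
      rfl

end Types

/-! ### The cubic of a plane in coordinates -/

section CubicForms

open MvPolynomial

/-- The rows of `P` are the parameters of the basis vectors pulled back to the model plane. The
congruence by `A` contributes the factor `k = (det A)²`. -/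
lemma exists_cubicForm_eq {W : Subsp5 F} {φ : (Fin 3 → F) →ₗ[F] (Fin 6 → F)}
    (h : SymCongruent (LinearMap.range φ) (submodule W)) (b : Module.Basis (Fin 3) F (submodule W)) :
    ∃ (P : Matrix (Fin 3) (Fin 3) F) (k : F), P.det ≠ 0 ∧ k ≠ 0 ∧ cubicForm b =
      C k * (∑ i : Fin 3, (X i : MvPolynomial (Fin 3) F) •
        (symMat (φ (P i))).map (C : F →+* MvPolynomial (Fin 3) F)).det := by
  obtain ⟨A, hA, hW⟩ := h
  have hb (i : Fin 3) : ∃ p : Fin 3 → F, congrLin A (φ p) = b i := by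
    obtain ⟨_, ⟨p, rfl⟩, hp⟩ := hW.ge (b i).2
    exact ⟨p, hp⟩
  choose P hP using hb
  refine ⟨P, A.det ^ 2, ?_, pow_ne_zero 2 hA, ?_⟩
  · have h1 : LinearIndependent F fun i => congrLin A (φ (P i)) := by
      simp only [hP]
      exact b.linearIndependent.map' (Submodule.subtype _) (Submodule.ker_subtype _)
    have h2 : LinearIndependent F P := LinearIndependent.of_comp ((congrLin A).comp φ) h1
    exact ((Matrix.isUnit_iff_isUnit_det P).mp
      (Matrix.linearIndependent_rows_iff_isUnit.mp h2)).ne_zero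
  · have h1 : ∑ i : Fin 3, (X i : MvPolynomial (Fin 3) F) • (symMat (b i : Fin 6 → F)).map
        (C : F →+* MvPolynomial (Fin 3) F) = A.map C *
        (∑ i : Fin 3, (X i : MvPolynomial (Fin 3) F) •
        (symMat (φ (P i))).map (C : F →+* MvPolynomial (Fin 3) F)) * (A.map C)ᵀ := by
      rw [Finset.mul_sum, Finset.sum_mul]
      refine Finset.sum_congr rfl fun i _ => ?_
      rw [← hP, symMat_congrLin, Matrix.map_mul, Matrix.map_mul, Matrix.mul_smul, Matrix.smul_mul,
        Matrix.transpose_map]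
    have h2 : (A.map (C : F →+* MvPolynomial (Fin 3) F)).det = C A.det := by
      rw [← RingHom.mapMatrix_apply, ← RingHom.map_det]
    rw [cubicForm, h1, Matrix.det_mul, Matrix.det_mul, Matrix.det_transpose, h2, map_pow]
    ring

variable [CharP F 2]

lemma exists_cubicForm_planeI_eq {W : Subsp5 F} {α β γ δ : F}
    (h : SymCongruent (LinearMap.range (planeI α β γ δ)) (submodule W))
    (b : Module.Basis (Fin 3) F (submodule W)) :
    ∃ (P : Matrix (Fin 3) (Fin 3) F) (k : F), P.det ≠ 0 ∧ k ≠ 0 ∧ cubicForm b =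
      C k * (linForm P 0 * (C γ * linForm P 0 + C δ * linForm P 1) ^ 2 +
        linForm P 1 * (C α * linForm P 0 + C β * linForm P 1) ^ 2) := by
  obtain ⟨P, k, hP, hk, hb⟩ := exists_cubicForm_eq h b
  refine ⟨P, k, hP, hk, hb.trans ?_⟩
  have h2 : (2 : MvPolynomial (Fin 3) F) = 0 := by
    rw [← map_ofNat (C (σ := Fin 3) (R := F)) 2, CharTwo.two_eq_zero, map_zero]
  have h1 : ∑ i : Fin 3, (X i : MvPolynomial (Fin 3) F) •
      (symMat (planeI α β γ δ (P i))).map (C : F →+* MvPolynomial (Fin 3) F) =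
      !![linForm P 0, linForm P 2, C α * linForm P 0 + C β * linForm P 1;
        linForm P 2, linForm P 1, C γ * linForm P 0 + C δ * linForm P 1;
        C α * linForm P 0 + C β * linForm P 1, C γ * linForm P 0 + C δ * linForm P 1, 0] := by
    ext1 i j
    fin_cases i <;> fin_cases j <;>
      simp [Fin.sum_univ_three, linForm, symMat, planeI_apply] <;> ring
  rw [h1, Matrix.det_fin_three]
  generalize linForm P 0 = x
  generalize linForm P 1 = y
  generalize linForm P 2 = z
  generalize (C α : MvPolynomial (Fin 3) F) = α
  generalize (C β : MvPolynomial (Fin 3) F) = β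
  generalize (C γ : MvPolynomial (Fin 3) F) = γ
  generalize (C δ : MvPolynomial (Fin 3) F) = δ
  congr 1
  simp
  linear_combination (z * (γ * x + δ * y) * (α * x + β * y)
    - x * (γ * x + δ * y) ^ 2 - y * (α * x + β * y) ^ 2) * h2

lemma exists_cubicForm_planeII_eq {W : Subsp5 F} {α β γ δ : F}
    (h : SymCongruent (LinearMap.range (planeII α β γ δ)) (submodule W))
    (b : Module.Basis (Fin 3) F (submodule W)) :
    ∃ (P : Matrix (Fin 3) (Fin 3) F) (k : F), P.det ≠ 0 ∧ k ≠ 0 ∧ cubicForm b =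
      C k * (linForm P 0 * linForm P 2 ^ 2 +
        linForm P 1 * (C γ * linForm P 0 + C δ * linForm P 1) ^ 2) := by
  obtain ⟨P, k, hP, hk, hb⟩ := exists_cubicForm_eq h b
  refine ⟨P, k, hP, hk, hb.trans ?_⟩
  have h2 : (2 : MvPolynomial (Fin 3) F) = 0 := by
    rw [← map_ofNat (C (σ := Fin 3) (R := F)) 2, CharTwo.two_eq_zero, map_zero]
  have h1 : ∑ i : Fin 3, (X i : MvPolynomial (Fin 3) F) •
      (symMat (planeII α β γ δ (P i))).map (C : F →+* MvPolynomial (Fin 3) F) =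
      !![linForm P 0, C α * linForm P 0 + C β * linForm P 1, C γ * linForm P 0 + C δ * linForm P 1;
        C α * linForm P 0 + C β * linForm P 1, linForm P 1, linForm P 2;
        C γ * linForm P 0 + C δ * linForm P 1, linForm P 2, 0] := by
    ext1 i j
    fin_cases i <;> fin_cases j <;>
      simp [Fin.sum_univ_three, linForm, symMat, planeII_apply] <;> ring
  rw [h1, Matrix.det_fin_three]
  generalize linForm P 0 = x
  generalize linForm P 1 = y
  generalize linForm P 2 = z
  generalize (C α : MvPolynomial (Fin 3) F) = α
  generalize (C β : MvPolynomial (Fin 3) F) = β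
  generalize (C γ : MvPolynomial (Fin 3) F) = γ
  generalize (C δ : MvPolynomial (Fin 3) F) = δ
  congr 1
  simp
  linear_combination (z * (γ * x + δ * y) * (α * x + β * y)
    - x * z ^ 2 - y * (γ * x + δ * y) ^ 2) * h2

/-- The gradient of `l m²` vanishes along the line `m = 0`. In characteristic 2 the gradient of `x
z² + x² y` vanishes only where `x = z = 0`, a single projective point. -/
lemma not_isLineAndDoubleLine_of_eq {P : Matrix (Fin 3) (Fin 3) F} (hP : P.det ≠ 0) {k : F}
    (hk : k ≠ 0) : ¬IsLineAndDoubleLine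
      (C k * (linForm P 0 * (linForm P 2 ^ 2 + linForm P 0 * linForm P 1))) := by
  rintro ⟨l, m, -, hm, -, h⟩
  have h2 : (2 : F) = 0 := CharTwo.two_eq_zero
  obtain ⟨g, hg⟩ := exists_eq_linForm hm
  have hpd (v : Fin 3 → F) (hv : eval v m = 0) (i : Fin 3) :
      P i 0 * eval v (linForm P 2) ^ 2 + P i 1 * eval v (linForm P 0) ^ 2 = 0 := by
    have := congrArg (eval v) (congrArg (pderiv i) h)
    simp only [Derivation.leibniz, Derivation.leibniz_pow, pderiv_linForm, smul_eq_mul,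
      nsmul_eq_mul, map_add, map_mul, map_pow, eval_C, hv, pderiv_C] at this
    simp only [Nat.add_one_sub_one, pow_one, Nat.cast_ofNat, map_ofNat, h2, zero_mul, mul_zero,
      add_zero, map_zero, zero_add, ne_eq, OfNat.ofNat_ne_zero, not_false_eq_true,
      zero_pow, mul_eq_zero, hk, false_or] at this
    linear_combination this - eval v (linForm P 0) * eval v (linForm P 1) * P i 0 * h2
  have hz (v : Fin 3 → F) (hv : eval v m = 0) :
      eval v (linForm P 0) = 0 ∧ eval v (linForm P 2) = 0 := by
    have h0 : P *ᵥ ![eval v (linForm P 2) ^ 2, eval v (linForm P 0) ^ 2, 0] = 0 := by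
      ext i
      simpa [Matrix.mulVec, dotProduct, Fin.sum_univ_three] using hpd v hv i
    have h3 : ![eval v (linForm P 2) ^ 2, eval v (linForm P 0) ^ 2, 0] = 0 := by
      by_contra hne
      exact hP (Matrix.exists_mulVec_eq_zero_iff.mp ⟨_, hne, h0⟩)
    exact ⟨pow_eq_zero_iff two_ne_zero |>.mp (congrFun h3 1),
      pow_eq_zero_iff two_ne_zero |>.mp (congrFun h3 0)⟩
  obtain ⟨u, hu⟩ := exists_eval_linForm hP ![1, 0, 0]
  obtain ⟨v, hv⟩ := exists_eval_linForm hP ![0, 0, 1]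
  have hlin (P' : Matrix (Fin 3) (Fin 3) F) (a c : F) (j : Fin 3) :
      eval (a • u + c • v) (linForm P' j) =
        a * eval u (linForm P' j) + c * eval v (linForm P' j) := by
    simp only [eval_linForm, Matrix.add_vecMul, Matrix.smul_vecMul]
    rfl
  -- The line `m = 0` meets the line through `u` and `v`, on which `x` and `z` do not vanish
  -- together.
  have hmlin : eval (eval v m • u + (-eval u m) • v) m = 0 := by
    simp only [hg, Fin.sum_univ_three, Pi.add_apply, Pi.smul_apply, smul_eq_mul]
    ring
  obtain ⟨e0, e2⟩ := hz _ hmlin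
  rw [hlin, hu, hv] at e0 e2
  have hv0 : eval v m = 0 := by simpa using e0
  simpa [hv] using (hz v hv0).2

/-- All points of `z = 0` are singular on `x z²`. A singular point of `l Q` off `l = 0` would be
singular on `Q`, so `l` is a multiple of `z`. Cancelling `z` makes `Q` a multiple of `x z`, which is
singular where `x = z = 0`. -/
lemma not_isConicAndTangent_of_eq {P : Matrix (Fin 3) (Fin 3) F} (hP : P.det ≠ 0) {k : F}
    (hk : k ≠ 0) : ¬IsConicAndTangent (C k * (linForm P 0 * linForm P 2 ^ 2)) := by
  rintro ⟨l, Q, ⟨-, hQ⟩, ⟨p, c, -, hc, -, hl⟩, h⟩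
  have h2 : (2 : F) = 0 := CharTwo.two_eq_zero
  have hns (v : Fin 3 → F) (hv : v ≠ 0) (hv0 : eval v Q = 0) : ∃ i, eval v (pderiv i Q) ≠ 0 := by
    have hae (f : MvPolynomial (Fin 3) F) :
        aeval (fun i => algebraMap F (AlgebraicClosure F) (v i)) f = algebraMap F _ (eval v f) := by
      simpa [Function.comp_def] using aeval_algebraMap_apply (AlgebraicClosure F) v f
    obtain ⟨i, hi⟩ := hQ (fun i => algebraMap F (AlgebraicClosure F) (v i)) (by
      contrapose! hv
      ext i
      simpa using congrFun hv i) (by rw [hae, hv0, map_zero])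
    rw [hae] at hi
    exact ⟨i, fun h0 => hi (by rw [h0, map_zero])⟩
  have hsing (v : Fin 3 → F) (hv : v ≠ 0) (hv2 : eval v (linForm P 2) = 0) : eval v l = 0 := by
    by_contra hlv
    have hf := congrArg (eval v) h
    simp only [map_mul, map_pow, hv2, ne_eq, OfNat.ofNat_ne_zero, not_false_eq_true, zero_pow,
      mul_zero, zero_eq_mul, hlv, false_or] at hf
    obtain ⟨i, hi⟩ := hns v hv hf
    have := congrArg (eval v) (congrArg (pderiv i) h)
    simp only [Derivation.leibniz, Derivation.leibniz_pow, smul_eq_mul,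
      nsmul_eq_mul, map_add, map_mul, map_pow, hv2, hf, pderiv_C] at this
    simp only [ne_eq, OfNat.ofNat_ne_zero, not_false_eq_true, zero_pow, Nat.add_one_sub_one,
      pow_one, Nat.cast_ofNat, map_ofNat, h2, zero_mul, mul_zero, add_zero, map_zero,
      zero_eq_mul, hlv, false_or] at this
    exact hi this
  obtain ⟨g, hg⟩ : ∃ g : Fin 3 → F, l = ∑ j, C (g j) * linForm P j := by
    refine ⟨P⁻¹ *ᵥ fun i => c * eval p (pderiv i Q), ?_⟩
    have hPP : P *ᵥ (P⁻¹ *ᵥ fun i => c * eval p (pderiv i Q)) =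
        fun i => c * eval p (pderiv i Q) := by
      rw [Matrix.mulVec_mulVec, Matrix.mul_nonsing_inv _ (Ne.isUnit hP), Matrix.one_mulVec]
    rw [hl, Finset.mul_sum]
    generalize P⁻¹ *ᵥ (fun i => c * eval p (pderiv i Q)) = g at hPP
    simp only [linForm, Finset.mul_sum]
    rw [Finset.sum_comm]
    refine Finset.sum_congr rfl fun i _ => ?_
    rw [← mul_assoc, ← C_mul, ← congrFun hPP i]
    simp only [Matrix.mulVec, dotProduct, map_sum, Finset.sum_mul, C_mul]
    exact Finset.sum_congr rfl fun j _ => by ring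
  obtain ⟨u, hu⟩ := exists_eval_linForm hP ![1, 0, 0]
  obtain ⟨v, hv⟩ := exists_eval_linForm hP ![0, 1, 0]
  obtain ⟨w, hw⟩ := exists_eval_linForm hP ![1, 0, 1]
  have hne {v : Fin 3 → F} {x : Fin 3 → F} (hv : ∀ j, eval v (linForm P j) = x j) (hx : x ≠ 0) :
      v ≠ 0 := by
    rintro rfl
    apply hx
    ext j
    rw [← hv, eval_linForm, Matrix.zero_vecMul]
  have hu0 : u ≠ 0 := hne hu fun h0 => by simpa using congrFun h0 0
  have hv0 : v ≠ 0 := hne hv fun h0 => by simpa using congrFun h0 1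
  have g0 : g 0 = 0 := by
    have := hsing u hu0 (hu 2)
    rw [hg] at this
    simpa [Fin.sum_univ_three, hu] using this
  have g1 : g 1 = 0 := by
    have := hsing v hv0 (hv 2)
    rw [hg] at this
    simpa [Fin.sum_univ_three, hv] using this
  have hlg : l = C (g 2) * linForm P 2 := by
    rw [hg, Fin.sum_univ_three, g0, g1]
    simp
  have hcancel : C k * (linForm P 0 * linForm P 2) = C (g 2) * Q := by
    apply mul_left_cancel₀ ((linearIndependent_linForm hP).ne_zero 2)
    rw [hlg] at h
    linear_combination h
  have hg2 : g 2 ≠ 0 := by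
    intro h0
    have := congrArg (eval w) hcancel
    simp [hw, h0, hk] at this
  have hQv : eval v Q = 0 := by
    have := congrArg (eval v) hcancel
    simpa [hv, hg2] using this
  obtain ⟨i, hi⟩ := hns v hv0 hQv
  have := congrArg (eval v) (congrArg (pderiv i) hcancel)
  simp [Derivation.leibniz, hv, hg2] at this
  exact hi this

end CubicForms

/-! ### The classification -/

section Classification

variable [CharP F 2] [Fintype F]

/-- The number of points of rank two outside the nucleus plane, for each of the six orbits. -/
def secantCount (q : ℕ) : Fin 6 → ℕ := ![0, 3 * q, q, q, 2 * q, 2 * q]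

theorem exists_representatives (F : Type u) [Field F] [CharP F 2] [Fintype F] :
    ∃ S : Fin 6 → Submodule F (Fin 6 → F),
      (∀ i, IsNucleusPointSpace (S i)) ∧
      (∀ W ∈ nucleusPointPlanes F, ∃ i, SymCongruent (S i) (submodule W)) ∧
      (∀ i (W : Subsp5 F), SymCongruent (S i) (submodule W) →
        OD0 W = ![0, 1, secantCount (Fintype.card F) i,
          Fintype.card F ^ 2 + Fintype.card F - secantCount (Fintype.card F) i]) ∧
      ∀ (W : Subsp5 F) (b : Module.Basis (Fin 3) F (submodule W)),
        (SymCongruent (S 2) (submodule W) → IsLineAndImaginaryPair (cubicForm b)) ∧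
        (SymCongruent (S 3) (submodule W) → IsAbsolutelyIrreducible (cubicForm b)) ∧
        (SymCongruent (S 4) (submodule W) →
          IsLineAndDoubleLine (cubicForm b) ∧ ¬IsConicAndTangent (cubicForm b)) ∧
        (SymCongruent (S 5) (submodule W) →
          IsConicAndTangent (cubicForm b) ∧ ¬IsLineAndDoubleLine (cubicForm b)) := by
  obtain ⟨α, β, γ, δ, hD, hfix⟩ := exists_planeI_forall_isFixedVector F
  obtain ⟨e, he⟩ := exists_forall_sq_add_self_add_ne_zero F
  let φ : Fin 6 → (Fin 3 → F) →ₗ[F] (Fin 6 → F) :=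
    ![planeI α β γ δ, planeI 1 0 0 1, planeI 1 e 0 1, planeII 1 0 0 1, planeII e 1 0 0,
      planeII 0 1 1 0]
  have hinj (i : Fin 6) : Function.Injective (φ i) := by
    fin_cases i
    exacts [planeI_injective _ _ _ _, planeI_injective _ _ _ _, planeI_injective _ _ _ _,
      planeII_injective _ _ _ _, planeII_injective _ _ _ _, planeII_injective _ _ _ _]
  have hN (i : Fin 6) : IsNucleusPointSpace (LinearMap.range (φ i)) := by
    fin_cases i
    exacts [isNucleusPointSpace_planeI hD, isNucleusPointSpace_planeI (by simp),
      isNucleusPointSpace_planeI (by simp), isNucleusPointSpace_planeII_one_zero,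
      isNucleusPointSpace_planeII_of_forall_ne_zero he, isNucleusPointSpace_planeII_zero_one]
  -- Writing `q = n + 1` removes the truncated subtraction `q - 1` from the counts.
  obtain ⟨n, hn⟩ : ∃ n, Fintype.card F = n + 1 :=
    ⟨Fintype.card F - 1, by have := Fintype.card_pos (α := F); omega⟩
  have hcount (i : Fin 6) : {x : Fin 3 → F | (symMat (φ i x)).det = 0}.ncard =
      (secantCount (Fintype.card F) i + 1) * (Fintype.card F - 1) + 1 := by
    fin_cases i
    · refine (ncard_planeI_of_forall hD hfix).trans ?_
      simp [secantCount, hn]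
    · refine ncard_planeI_one.trans ?_
      simp [secantCount, hn]
      ring
    · refine (ncard_planeI_of_forall_ne_zero he).trans ?_
      simp [secantCount, hn]
      ring
    · refine ncard_planeII_one_zero.trans ?_
      simp [secantCount, hn]
      ring
    · refine (ncard_planeII_of_snd_eq_zero _ _).trans ?_
      simp [secantCount, hn]
      ring
    · refine ncard_planeII_zero_one.trans ?_
      simp [secantCount, hn]
      ring
  have h2 : (2 : MvPolynomial (Fin 3) F) = 0 := by
    rw [← map_ofNat (MvPolynomial.C (σ := Fin 3) (R := F)) 2, CharTwo.two_eq_zero, map_zero]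
  refine ⟨fun i => LinearMap.range (φ i), hN, fun W hW => ?_, fun i W hW =>
    OD0_eq_of_congruent (hN i) (hinj i) hW (hcount i), fun W b => ⟨fun h => ?_, fun h => ?_,
      fun h => ?_, fun h => ?_⟩⟩
  · have hS := (mem_nucleusPointPlanes_iff W).mp hW
    obtain ⟨α', β', γ', δ', h | h⟩ := hS.exists_congruent
    · obtain h' | h' | ⟨e', he', h'⟩ := congruent_of_planeI hD hfix (h.isNucleusPointSpace hS)
      · exact ⟨0, (h.trans h').symm⟩
      · exact ⟨1, (h.trans h').symm⟩
      · exact ⟨2, (h.trans (h'.trans (congruent_planeI_of_forall_ne_zero he' he))).symm⟩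
    · obtain h' | h' | ⟨e', he', h'⟩ := congruent_of_planeII (h.isNucleusPointSpace hS)
      · exact ⟨3, (h.trans h').symm⟩
      · exact ⟨5, (h.trans h').symm⟩
      · exact ⟨4, (h.trans (h'.trans (congruent_planeII_of_forall_ne_zero he' he))).symm⟩
  · obtain ⟨P, k, hP, hk, hb⟩ := exists_cubicForm_planeI_eq (α := 1) (β := e) (γ := 0) (δ := 1) h b
    rw [hb]
    convert isLineAndImaginaryPair_of_eq hP hk (sq_add_self_add_sq_ne_zero he) using 1
    simp only [map_zero, map_one, map_pow]
    linear_combination MvPolynomial.C k * linForm P 1 * linForm P 0 * linForm P 1 *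
      MvPolynomial.C e * h2
  · obtain ⟨P, k, hP, hk, hb⟩ := exists_cubicForm_planeII_eq (α := 1) (β := 0) (γ := 0) (δ := 1) h b
    rw [hb]
    convert isAbsolutelyIrreducible_of_eq hP hk using 1
    simp only [map_zero, map_one]
    ring
  · obtain ⟨P, k, hP, hk, hb⟩ := exists_cubicForm_planeII_eq (α := e) (β := 1) (γ := 0) (δ := 0) h b
    have hb' : cubicForm b = MvPolynomial.C k * (linForm P 0 * linForm P 2 ^ 2) := by
      rw [hb]
      simp only [map_zero]
      ring
    rw [hb']
    exact ⟨isLineAndDoubleLine_of_eq hP hk, not_isConicAndTangent_of_eq hP hk⟩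
  · obtain ⟨P, k, hP, hk, hb⟩ := exists_cubicForm_planeII_eq (α := 0) (β := 1) (γ := 1) (δ := 0) h b
    have hb' : cubicForm b = MvPolynomial.C k *
        (linForm P 0 * (linForm P 2 ^ 2 + linForm P 0 * linForm P 1)) := by
      rw [hb]
      simp only [map_zero, map_one]
      ring
    rw [hb']
    exact ⟨isConicAndTangent_of_eq hP hk, not_isLineAndDoubleLine_of_eq hP hk⟩

end Classification

end VeronesePlanes

end

/-! ### The six orbits, their distributions and the types of their cubics -/

open VeronesePlanes in
theorem mainTheorem6 {F : Type*} [Field F] [Fintype F] [CharP F 2] (q : ℕ)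
    (hq : Fintype.card F = q) :
    (VeronesePlanes.orbits F).ncard = 6 ∧
    (VeronesePlanes.orbitsWithOD F ![0, 1, 0, q ^ 2 + q]).ncard = 1 ∧
    (VeronesePlanes.orbitsWithOD F ![0, 1, 3 * q, q ^ 2 - 2 * q]).ncard = 1 ∧
    (∃ O₁ O₂ : Set (VeronesePlanes.Subsp5 F), O₁ ≠ O₂ ∧
      VeronesePlanes.orbitsWithOD F ![0, 1, q, q ^ 2] = {O₁, O₂} ∧
      O₁ = VeronesePlanes.planesOfType ![0, 1, q, q ^ 2] VeronesePlanes.IsLineAndImaginaryPair ∧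
      O₂ = VeronesePlanes.planesOfType ![0, 1, q, q ^ 2] VeronesePlanes.IsAbsolutelyIrreducible) ∧
    (∃ O₁ O₂ : Set (VeronesePlanes.Subsp5 F), O₁ ≠ O₂ ∧
      VeronesePlanes.orbitsWithOD F ![0, 1, 2 * q, q ^ 2 - q] = {O₁, O₂} ∧
      O₁ = VeronesePlanes.planesOfType ![0, 1, 2 * q, q ^ 2 - q]
        VeronesePlanes.IsLineAndDoubleLine ∧
      O₂ = VeronesePlanes.planesOfType ![0, 1, 2 * q, q ^ 2 - q]
        VeronesePlanes.IsConicAndTangent) := by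
  subst hq
  obtain ⟨S, hN, hcl, hOD, htype⟩ := exists_representatives F
  set q := Fintype.card F with hq
  have hq0 : 0 < q := Fintype.card_pos
  let O : Fin 6 → Set (Subsp5 F) := fun i => kOrbit (S i).projectivization
  have hO (i : Fin 6) (W : Subsp5 F) :
      W ∈ O i ↔ SymCongruent (S i) (Projectivization.Subspace.submodule W) := by
    rw [mem_kOrbit_iff, OrderIso.apply_symm_apply]
  have hmem (i : Fin 6) (W : Subsp5 F) (h : W ∈ O i) : W ∈ nucleusPointPlanes F :=
    (mem_nucleusPointPlanes_iff W).mpr (((hO i W).mp h).isNucleusPointSpace (hN i))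
  have hself (i : Fin 6) : (S i).projectivization ∈ O i := by
    rw [hO, OrderIso.apply_symm_apply]
    exact SymCongruent.refl _
  have horb : orbits F = Set.range O := by
    ext X
    constructor
    · rintro ⟨W, hW, rfl⟩
      obtain ⟨i, hi⟩ := hcl W hW
      refine ⟨i, (kOrbit_eq_iff _ _).mpr ?_⟩
      rwa [OrderIso.apply_symm_apply]
    · rintro ⟨i, rfl⟩
      exact ⟨_, hmem i _ (hself i), rfl⟩
  have hbasis (i : Fin 6) (W : Subsp5 F) (h : W ∈ O i) :
      Nonempty (Module.Basis (Fin 3) F (Projectivization.Subspace.submodule W)) :=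
    ⟨Module.finBasisOfFinrankEq F _ (hmem i W h).1⟩
  have hcount (i : Fin 6) (W : Subsp5 F) (h : W ∈ O i) (d : ℕ)
      (hd : OD0 W = ![0, 1, d, q ^ 2 + q - d]) : secantCount q i = d := by
    have := congrFun ((hOD i W ((hO i W).mp h)).symm.trans hd) 2
    simpa using this
  have hex23 (W : Subsp5 F) (h2 : W ∈ O 2) (h3 : W ∈ O 3) : False := by
    obtain ⟨b⟩ := hbasis 2 W h2
    exact ((htype W b).2.1 ((hO 3 W).mp h3)).not_isLineAndImaginaryPair
      ((htype W b).1 ((hO 2 W).mp h2))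
  have hex45 (W : Subsp5 F) (h4 : W ∈ O 4) (h5 : W ∈ O 5) : False := by
    obtain ⟨b⟩ := hbasis 4 W h4
    exact ((htype W b).2.2.2 ((hO 5 W).mp h5)).2 ((htype W b).2.2.1 ((hO 4 W).mp h4)).1
  have hinj : Function.Injective O := by
    intro i j hij
    have hj : (S i).projectivization ∈ O j := hij ▸ hself i
    have hc := hcount j _ hj _ (hOD i _ ((hO i _).mp (hself i)))
    fin_cases i <;> fin_cases j <;> first
      | rfl
      | exact (hex23 _ (hself 2) hj).elim
      | exact (hex23 _ hj (hself 3)).elim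
      | exact (hex45 _ (hself 4) hj).elim
      | exact (hex45 _ hj (hself 5)).elim
      | (exfalso; revert hc; simp [secantCount]; done)
      | (exfalso; revert hc; simp [secantCount]; omega)
  have hwith (d : ℕ) : orbitsWithOD F ![0, 1, d, q ^ 2 + q - d] =
      O '' {i | secantCount q i = d} := by
    ext X
    constructor
    · rintro ⟨hX, h⟩
      rw [horb] at hX
      obtain ⟨i, rfl⟩ := hX
      exact ⟨i, hcount i _ (hself i) d (h _ (hself i)), rfl⟩
    · rintro ⟨i, rfl, rfl⟩
      exact ⟨horb ▸ ⟨i, rfl⟩, fun W hW => hOD i W ((hO i W).mp hW)⟩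
  -- To identify an orbit by its cubic, it suffices that `T` holds on it and fails on every other
  -- orbit with the same distribution.
  have hplanes (i : Fin 6) (T : MvPolynomial (Fin 3) F → Prop)
      (hT : ∀ W ∈ O i, ∀ b : Module.Basis (Fin 3) F (Projectivization.Subspace.submodule W),
        T (cubicForm b))
      (hT' : ∀ j ≠ i, secantCount q j = secantCount q i → ∀ W ∈ O j,
        ∀ b : Module.Basis (Fin 3) F (Projectivization.Subspace.submodule W), ¬T (cubicForm b)) :
      O i = planesOfType ![0, 1, secantCount q i, q ^ 2 + q - secantCount q i] T := by
    ext W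
    constructor
    · intro hW
      exact ⟨hmem i W hW, hOD i W ((hO i W).mp hW), hT W hW⟩
    · rintro ⟨hW, hd, hb⟩
      obtain ⟨j, hj⟩ := hcl W hW
      rw [← hO] at hj
      by_contra hne
      obtain ⟨b⟩ := hbasis j W hj
      exact hT' j (fun h => hne (h ▸ hj)) (hcount j W hj _ hd) W hj b (hb b)
  have e1 : q ^ 2 + q = q ^ 2 + q - 0 := rfl
  -- The stated last entries are brought to the form `q ^ 2 + q - d` used in `hwith`; the identities
  -- also hold for truncated subtraction.
  have e2 : q ^ 2 - 2 * q = q ^ 2 + q - 3 * q := by omega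
  have e3 : q ^ 2 = q ^ 2 + q - q := by omega
  have e4 : q ^ 2 - q = q ^ 2 + q - 2 * q := by omega
  have s1 : {i | secantCount q i = 0} = {0} := by
    ext i
    fin_cases i <;> simp [secantCount] <;> omega
  have s2 : {i | secantCount q i = 3 * q} = {1} := by
    ext i
    fin_cases i <;> simp [secantCount] <;> omega
  have s3 : {i | secantCount q i = q} = {2, 3} := by
    ext i
    fin_cases i <;> simp [secantCount] <;> omega
  have s4 : {i | secantCount q i = 2 * q} = {4, 5} := by
    ext i
    fin_cases i <;> simp [secantCount] <;> omega
  refine ⟨?_, ?_, ?_, ⟨O 2, O 3, ?_, ?_, ?_, ?_⟩, ⟨O 4, O 5, ?_, ?_, ?_, ?_⟩⟩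
  · rw [horb, ← Set.image_univ, Set.ncard_image_of_injective _ hinj, Set.ncard_univ]
    simp
  · rw [e1, hwith, s1, Set.image_singleton, Set.ncard_singleton]
  · rw [e2, hwith, s2, Set.image_singleton, Set.ncard_singleton]
  · exact fun h => absurd (hinj h) (by decide)
  · rw [show (![0, 1, q, q ^ 2] : Fin 4 → ℕ) = ![0, 1, q, q ^ 2 + q - q] by rw [← e3], hwith, s3,
      Set.image_pair]
  · rw [show (![0, 1, q, q ^ 2] : Fin 4 → ℕ) = ![0, 1, q, q ^ 2 + q - q] by rw [← e3]]
    refine hplanes 2 _ (fun W hW b => (htype W b).1 ((hO 2 W).mp hW)) fun j hj hc W hW b h => ?_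
    obtain rfl | rfl : j = 2 ∨ j = 3 := (Set.ext_iff.mp s3 j).mp hc
    · exact hj rfl
    · exact ((htype W b).2.1 ((hO 3 W).mp hW)).not_isLineAndImaginaryPair h
  · rw [show (![0, 1, q, q ^ 2] : Fin 4 → ℕ) = ![0, 1, q, q ^ 2 + q - q] by rw [← e3]]
    refine hplanes 3 _ (fun W hW b => (htype W b).2.1 ((hO 3 W).mp hW)) fun j hj hc W hW b h => ?_
    obtain rfl | rfl : j = 2 ∨ j = 3 := (Set.ext_iff.mp s3 j).mp hc
    · exact h.not_isLineAndImaginaryPair ((htype W b).1 ((hO 2 W).mp hW))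
    · exact hj rfl
  · exact fun h => absurd (hinj h) (by decide)
  · rw [e4, hwith, s4, Set.image_pair]
  · rw [e4]
    refine hplanes 4 _ (fun W hW b => ((htype W b).2.2.1 ((hO 4 W).mp hW)).1)
      fun j hj hc W hW b h => ?_
    obtain rfl | rfl : j = 4 ∨ j = 5 := (Set.ext_iff.mp s4 j).mp hc
    · exact hj rfl
    · exact ((htype W b).2.2.2 ((hO 5 W).mp hW)).2 h
  · rw [e4]
    refine hplanes 5 _ (fun W hW b => ((htype W b).2.2.2 ((hO 5 W).mp hW)).1)
      fun j hj hc W hW b h => ?_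
    obtain rfl | rfl : j = 4 ∨ j = 5 := (Set.ext_iff.mp s4 j).mp hc
    · exact ((htype W b).2.2.1 ((hO 4 W).mp hW)).2 h
    · exact hj rfl
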